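/- **The doubly hexagonal chain.** Let $D_0$ be the path $P_4$ with vertices $a,b,c,d$ in this order and $S_0=\{a,b,c,d\}$. For $n\ge1$, $D_n$ is obtained from $D_{n-1}$ by adding a new path with vertices $a',b',c',d'$, an edge $cb'$, and two paths $a\,t\,a'$ and $d\,u\,d'$ of length two with new inner vertices $t,u$, where $a,b,c,d$ are the vertices of $S_{n-1}$; then $S=S_n=\{a',b',c',d'\}$ (renamed $a,b,c,d$). (Each step adds the two hexagons $abcb'a't$ and $cdud'c'b'$. Everything below also holds for the version of $D_n$ without $t,u$, in which $aa'$ and $dd'$ are edges, i.e. for the linear family of fasciagraphs with $D_0=H=P_4$.) An embedding of a graph is a rotation system (a cyclic permutation of the incident edges at every vertex); its genus is $1+\frac12(|E|-|V|-f)$, where $f$ is the number of facial walks. The $S$-type of an embedding is the family of cyclic sequences of vertices of $S$ met by the facial walks that meet $S$; an $S$-type is identified with its inverse (all cyclic sequences reversed). Let $\tau_0=(ba)(abcd)(dcb)$, $\tau_1=(baabcd)(dcb)$, $\tau_2=(badcb)(abcd)$, $\tau_3=(ba)(abcddcb)$, $\tau_4=(baabcddcb)$, $\tau_5=(badcbabcd)$.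 For each $\tau$ let $\alpha(\tau)=\sum_{g\ge0}\alpha_g(\tau)Y^g$, where $\alpha_g(\tau)$ is the number of embeddings of $D_n$ of genus $g$ and $S$-type $\tau$, and put $$\widehat\alpha(D_n,Y,S)=\bigl(\alpha(\tau_0),\ \alpha(\tau_1)+\alpha(\tau_2),\ \alpha(\tau_3),\ \alpha(\tau_4)+\alpha(\tau_5)\bigr)^T .$$ Let $$\widehat Q=\begin{pmatrix}1&2&4&8\\8Y&8Y&8Y&0\\2Y&4Y&0&0\\4Y^2+Y&2Y&4Y&8Y\end{pmatrix}.$$ **Theorem.** 1. The characteristic polynomial of $\widehat Q$ (over $\mathbb Z[Y]$) is $$\lambda^4-(16Y+1)\lambda^3-16Y\lambda^2+(512Y^3-64Y^2)\lambda+1024Y^4 .$$ 2. $\widehat Q$ is the reduced transfer matrix of the chain: for every $n\ge1$, $\widehat\alpha(D_n,Y,S)=\widehat Q^{\,n-1}(2,0,0,2Y)^T$ in $\mathbb Z[Y]^4$. 3. Let $K$ be a field of characteristic $0$ and let $Y\in K$ with $Y\ne0$, $4Y+1\neq0$ and $55296Y^3-2880Y^2+465Y+6\ne0$ (for instance an indeterminate).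 For any choice in $K$ of values of the radicals \begin{align*} z&=\Bigl(13824Y^6-864Y^5+207Y^4+Y^3+9\sqrt{55296Y^{10}-2880Y^9+465Y^8+6Y^7}\Bigr)^{1/3},\\ w&=\sqrt{(18432Y^4+768zY^2-768Y^3+32z^2+224Yz+32Y^2+3z)/z}, \end{align*} of $\sqrt3$, and of the two square roots below, with $z,w\neq0$, put \begin{align*} g&=-55296wY^4+4608wzY^2+2304wY^3-96wz^2+1344Yzw-96wY^2+18wz,\\ h&=41472\sqrt3\,zY^2+2016\sqrt3\,zY+18\sqrt3\,z,\\ \lambda_{1,2}&=4Y+\tfrac14+\tfrac{\sqrt3}{12}w\pm\tfrac1{12}\sqrt{\tfrac{g+h}{wz}},\qquad \lambda_{3,4}=4Y+\tfrac14-\tfrac{\sqrt3}{12}w\pm\tfrac1{12}\sqrt{\tfrac{g-h}{wz}} . \end{align*} Then the characteristic polynomial of $\widehat Q$ is $\prod_{i=1}^4(\lambda-\lambda_i)$ and the $\lambda_i$ are pairwise distinct. With $$\varphi_1(\lambda)=\frac{\lambda}{Y(4Y+\lambda)},\quad \varphi_2(\lambda)=\frac{\lambda(\lambda^2-(8Y+1)\lambda-32Y^2-8Y)}{2Y(\lambda^2+12Y\lambda+32Y^2)},\quad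 \varphi_3(\lambda)=\frac{2(\lambda^2-8Y\lambda-32Y^2)}{\lambda^2+12Y\lambda+32Y^2},$$ all denominators are nonzero at the $\lambda_i$, the matrix $N$ whose $i$-th column is $(\varphi_1(\lambda_i),\varphi_2(\lambda_i),\varphi_3(\lambda_i),1)^T$ is invertible, $N^{-1}\widehat QN=\mathrm{diag}(\lambda_1,\lambda_2,\lambda_3,\lambda_4)$, and for every $n\ge1$ $$\widehat\alpha(D_n,Y,S)=N\,\mathrm{diag}(\lambda_1^{n-1},\lambda_2^{n-1},\lambda_3^{n-1},\lambda_4^{n-1})\,N^{-1}\,(2,0,0,2Y)^T .$$ 4. A choice of the radicals as in 3 exists if $K$ is algebraically closed of characteristic $0$ and $Y\ne0$, $576Y^2-24Y+1\ne0$, $2304Y^2+112Y+1\ne0$. For real $Y>0$ one may take $K=\mathbb C$ and the principal values of all radicals: $z$ and $w$ are then positive reals, and $55296Y^3-2880Y^2+465Y+6>0$. -/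

import Mathlib

open Polynomial

/-! ### Linear families of fasciagraphs -/

/-- The constituents `(G₀, S₀)`, `(H, S)` and `B` of a linear family of fasciagraphs. The label type
`ι` indexes both `S₀` and `S`, so that the bijection `S₀ → S` is `s₀ i ↦ s i`. The bipartite graph
`B` between `S₀` and `V(H)` is the relation `B`. -/
structure Constituents (ι : Type) where
  V₀ : Type
  W : Type
  G₀ : SimpleGraph V₀
  H : SimpleGraph W
  s₀ : ι ↪ V₀
  s : ι ↪ W
  B : ι → W → Prop

namespace Constituents

variable {ι : Type} (C : Constituents ι)

/-- The vertices of the `n`-th fasciagraph. -/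
def V : ℕ → Type
  | 0 => C.V₀
  | n + 1 => V n ⊕ C.W

/-- The distinguished vertices `Sₙ` of the `n`-th fasciagraph, with their labels. -/
def mark : (n : ℕ) → ι → C.V n
  | 0 => C.s₀
  | _ + 1 => fun i => Sum.inr (C.s i)

/-- The `n`-th fasciagraph `Gₙ`: the disjoint union of `Gₙ₋₁` and a copy of `H`, plus the edges
of `B` between `Sₙ₋₁` and the copy of `H`. -/
def graph : (n : ℕ) → SimpleGraph (C.V n)
  | 0 => C.G₀
  | n + 1 =>
    { Adj := fun x y : C.V n ⊕ C.W =>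
        match x, y with
        | Sum.inl x, Sum.inl y => (graph n).Adj x y
        | Sum.inr x, Sum.inr y => C.H.Adj x y
        | Sum.inl x, Sum.inr y => ∃ i, C.mark n i = x ∧ C.B i y
        | Sum.inr x, Sum.inl y => ∃ i, C.mark n i = y ∧ C.B i x
      symm := ⟨by
        rintro (x | x) (y | y) h
        · exact (graph n).adj_symm h
        · exact h
        · exact h
        · exact C.H.adj_symm h⟩
      loopless := ⟨by
        rintro (x | x) h
        · exact (graph n).loopless.irrefl x h
        · exact C.H.loopless.irrefl x h⟩ }

end Constituents

/-! ### Rotation systems, facial walks, genus -/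

/-- A rotation system of a simple graph `G`: for each vertex `v` a cyclic permutation of the edges
incident with `v`, encoded as a permutation of the darts (oriented edges) whose orbits are exactly
the sets of darts with a common initial vertex. -/
structure RotationSystem {V : Type} (G : SimpleGraph V) where
  rot : Equiv.Perm G.Dart
  fst_rot : ∀ d, (rot d).fst = d.fst
  cyclic : ∀ d d' : G.Dart, d.fst = d'.fst → rot.SameCycle d d'

namespace RotationSystem

variable {V : Type} {G : SimpleGraph V} (R : RotationSystem G)

/-- One step of face tracing: walk along the dart `d` from `u` to `v`, then leave `v` along the
edge that follows `uv` in the rotation at `v`. -/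
def face : Equiv.Perm G.Dart :=
  (Function.Involutive.toPerm _ (SimpleGraph.Dart.symm_involutive (G := G))).trans R.rot

/-- The facial walks, i.e. the orbits of face tracing. -/
def Faces : Type := Quotient (Equiv.Perm.SameCycle.setoid R.face)

/-- The genus, by Euler's formula. -/
noncomputable def genus : ℚ :=
  1 + ((Nat.card G.edgeSet : ℚ) - Nat.card V - Nat.card R.Faces) / 2

end RotationSystem

/-! ### Types of facial walks and of embeddings -/

/-- Apply a partial function along a cyclic sequence, dropping the entries where it is undefined. -/
def cycleFilterMap {α β : Type} (f : α → Option β) : Cycle α → Cycle β :=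
  Quotient.map' (List.filterMap f) (by
    rintro l _ ⟨n, rfl⟩
    change List.filterMap f l ~r List.filterMap f (l.rotate n)
    rw [List.rotate_eq_drop_append_take_mod, List.filterMap_append]
    conv_lhs => rw [← List.take_append_drop (n % l.length) l, List.filterMap_append]
    exact List.isRotated_append)

namespace RotationSystem

variable {V : Type} {G : SimpleGraph V} {ι : Type} (s : ι → V) (R : RotationSystem G)

/-- The cyclic sequence of the labels of those vertices of `S` (the range of `s`) that are met when
the facial walk through the dart `d` is traversed. -/
noncomputable def dartType (d : G.Dart) : Cycle ι :=
  cycleFilterMap (fun e : G.Dart => Function.partialInv s e.fst)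
    (Function.periodicOrbit R.face d)

theorem dartType_eq_of_sameCycle (d d' : G.Dart) (h : R.face.SameCycle d d') :
    R.dartType s d = R.dartType s d' := by
  have key : ∀ (k : ℕ) (x : G.Dart),
      R.dartType s ((R.face ^ k) x) = R.dartType s x := by
    intro k x
    unfold dartType
    congr 1
    rw [← Equiv.Perm.iterate_eq_pow]
    by_cases hx : x ∈ Function.periodicPts R.face
    · exact Function.periodicOrbit_apply_iterate_eq hx k
    · rw [Function.periodicOrbit_eq_nil_of_not_periodic_pt hx,
        Function.periodicOrbit_eq_nil_of_not_periodic_pt]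
      rintro ⟨m, hm, hp⟩
      refine hx ⟨m, hm, ?_⟩
      have h1 : R.face^[k] (R.face^[m] x) = R.face^[k] x := by
        rw [← Function.iterate_add_apply, Nat.add_comm, Function.iterate_add_apply]
        exact hp
      exact (R.face.injective.iterate k) h1
  obtain ⟨k, rfl⟩ := h
  obtain ⟨m, rfl | rfl⟩ := k.eq_nat_or_neg
  · rw [zpow_natCast, key]
  · rw [← key m ((R.face ^ (-(m : ℤ))) d), ← Equiv.Perm.mul_apply, ← zpow_natCast, ← zpow_add,
      add_neg_cancel, zpow_zero, Equiv.Perm.one_apply]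

/-- The `S`-type of a facial walk; it is `Cycle.nil` if the walk contains no vertex of `S`. -/
noncomputable def faceType : R.Faces → Cycle ι :=
  Quotient.lift (R.dartType s) (R.dartType_eq_of_sameCycle s)

/-- `τ` is exactly the family (multiset) of `S`-types of the facial walks that meet `S`. -/
def HasOrientedType [DecidableEq ι] (τ : Multiset (Cycle ι)) : Prop :=
  ∀ c : Cycle ι, c ≠ Cycle.nil → Nat.card {F : R.Faces // R.faceType s F = c} = τ.count c

/-- The embedding has `S`-type `τ`, where `τ` is identified with its inverse. -/
def HasType [DecidableEq ι] (τ : Multiset (Cycle ι)) : Prop :=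
  R.HasOrientedType s τ ∨ R.HasOrientedType s (τ.map Cycle.reverse)

end RotationSystem

/-- The generating function `∑ g, α_g(τ) Y^g`, where `α_g(τ)` is the number of embeddings of `G` of
genus `g` and `S`-type `τ`. -/
noncomputable def stratifiedGenus {V : Type} (G : SimpleGraph V) {ι : Type} [DecidableEq ι]
    (s : ι → V) (τ : Multiset (Cycle ι)) : ℤ[X] :=
  ∑ᶠ g : ℕ, Polynomial.monomial g
    (Nat.card {R : RotationSystem G // R.genus = g ∧ R.HasType s τ} : ℤ)

/-! ### The doubly hexagonal chain -/

/-- The doubly hexagonal chain. Labels `0, 1, 2, 3` stand for `a, b, c, d`. One starts with the path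
`a b c d`. In every step a path `t a b c d u` (here `a, b, c, d` are `Sum.inl 0, …, Sum.inl 3`,
`t = Sum.inr 0` and `u = Sum.inr 1`) is added, together with the edges from the old `a` to `t`,
from the old `c` to the new `b`, and from the old `d` to `u`. This creates the two hexagons
`a b c b' a' t` and `c d u d' c' b'` (new vertices `a', b', c', d', t, u`). -/
def hexagonalConstituents : Constituents (Fin 4) where
  V₀ := Fin 4
  W := Fin 4 ⊕ Fin 2
  G₀ := SimpleGraph.pathGraph 4
  H := ((SimpleGraph.pathGraph 4).sum (⊥ : SimpleGraph (Fin 2))) ⊔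
    SimpleGraph.fromRel (fun x y =>
      (x = Sum.inl 0 ∧ y = Sum.inr 0) ∨ (x = Sum.inl 3 ∧ y = Sum.inr 1))
  s₀ := Function.Embedding.refl _
  s := Function.Embedding.inl
  B i w := (i = 0 ∧ w = Sum.inr 0) ∨ (i = 2 ∧ w = Sum.inl 1) ∨ (i = 3 ∧ w = Sum.inr 1)

/-- The version of the chain without the vertices `t` and `u` of degree 2: `D₀ = H = P₄`, and the
old `a, c, d` are joined to the new `a, b, d`, respectively. -/
def pathConstituents : Constituents (Fin 4) where
  V₀ := Fin 4
  W := Fin 4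
  G₀ := SimpleGraph.pathGraph 4
  H := SimpleGraph.pathGraph 4
  s₀ := Function.Embedding.refl _
  s := Function.Embedding.refl _
  B i w := (i = 0 ∧ w = 0) ∨ (i = 2 ∧ w = 1) ∨ (i = 3 ∧ w = 3)

/-- The cyclic sequence with the given entries. -/
def cyc (l : List (Fin 4)) : Cycle (Fin 4) := l

/-- The six `S`-types `τ₀ = (ba)(abcd)(dcb)`, `τ₁ = (baabcd)(dcb)`, `τ₂ = (badcb)(abcd)`,
`τ₃ = (ba)(abcddcb)`, `τ₄ = (baabcddcb)`, `τ₅ = (badcbabcd)`. -/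
def chainType : Fin 6 → Multiset (Cycle (Fin 4)) :=
  ![{cyc [1, 0], cyc [0, 1, 2, 3], cyc [3, 2, 1]},
    {cyc [1, 0, 0, 1, 2, 3], cyc [3, 2, 1]},
    {cyc [1, 0, 3, 2, 1], cyc [0, 1, 2, 3]},
    {cyc [1, 0], cyc [0, 1, 2, 3, 3, 2, 1]},
    {cyc [1, 0, 0, 1, 2, 3, 3, 2, 1]},
    {cyc [1, 0, 3, 2, 1, 0, 1, 2, 3]}]

/-- The entries of the stratified genus distribution `α(Dₙ, Y, S)`. -/
noncomputable def alpha (C : Constituents (Fin 4)) (n : ℕ) (i : Fin 6) : ℤ[X] :=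
  stratifiedGenus (C.graph n) (C.mark n) (chainType i)

/-- The reduced stratified genus distribution `α̂(Dₙ, Y, S)`, obtained by combining `τ₁, τ₂` and
combining `τ₄, τ₅`. -/
noncomputable def alphaHat (C : Constituents (Fin 4)) (n : ℕ) : Fin 4 → ℤ[X] :=
  ![alpha C n 0, alpha C n 1 + alpha C n 2, alpha C n 3, alpha C n 4 + alpha C n 5]

/-! ### The reduced transfer matrix and the radicals -/

/-- The reduced transfer matrix `Q̂`. -/
def reducedQ {R : Type*} [CommRing R] (Y : R) : Matrix (Fin 4) (Fin 4) R :=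
  !![1, 2, 4, 8;
     8 * Y, 8 * Y, 8 * Y, 0;
     2 * Y, 4 * Y, 0, 0;
     4 * Y ^ 2 + Y, 2 * Y, 4 * Y, 8 * Y]

section Radicals

variable {K : Type*} [Field K]

/-- The expression `g`. -/
def radG (Y z w : K) : K :=
  -55296 * w * Y ^ 4 + 4608 * w * z * Y ^ 2 + 2304 * w * Y ^ 3 - 96 * w * z ^ 2
    + 1344 * Y * z * w - 96 * w * Y ^ 2 + 18 * w * z

/-- The expression `h`; here `r` stands for `√3`. -/
def radH (r Y z : K) : K :=
  41472 * r * z * Y ^ 2 + 2016 * r * z * Y + 18 * r * z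

/-- A choice of values of the radicals in the formulas for the eigenvalues at `Y`:
`r = √3`, `s = √(55296 Y¹⁰ - 2880 Y⁹ + 465 Y⁸ + 6 Y⁷)`,
`z = (13824 Y⁶ - 864 Y⁵ + 207 Y⁴ + Y³ + 9 s)^(1/3)`, `w = √((18432 Y⁴ + ⋯ + 3z)/z)`,
`p = √((g+h)/(wz))`, `q = √((g-h)/(wz))`, with nonzero denominators. -/
structure Radicals (Y : K) where
  (r s z w p q : K)
  r_sq : r ^ 2 = 3
  s_sq : s ^ 2 = 55296 * Y ^ 10 - 2880 * Y ^ 9 + 465 * Y ^ 8 + 6 * Y ^ 7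
  z_cube : z ^ 3 = 13824 * Y ^ 6 - 864 * Y ^ 5 + 207 * Y ^ 4 + Y ^ 3 + 9 * s
  z_ne : z ≠ 0
  w_sq : w ^ 2 = (18432 * Y ^ 4 + 768 * z * Y ^ 2 - 768 * Y ^ 3 + 32 * z ^ 2 + 224 * Y * z
    + 32 * Y ^ 2 + 3 * z) / z
  w_ne : w ≠ 0
  p_sq : p ^ 2 = (radG Y z w + radH r Y z) / (w * z)
  q_sq : q ^ 2 = (radG Y z w - radH r Y z) / (w * z)

/-- The four eigenvalues in radicals. -/
def Radicals.eigenvalue {Y : K} (ρ : Radicals Y) : Fin 4 → K :=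
  ![4 * Y + 1 / 4 + ρ.r / 12 * ρ.w + 1 / 12 * ρ.p,
    4 * Y + 1 / 4 + ρ.r / 12 * ρ.w - 1 / 12 * ρ.p,
    4 * Y + 1 / 4 - ρ.r / 12 * ρ.w + 1 / 12 * ρ.q,
    4 * Y + 1 / 4 - ρ.r / 12 * ρ.w - 1 / 12 * ρ.q]

/-- `φ₁(λ)`. -/
def phi₁ (Y l : K) : K := l / (Y * (4 * Y + l))

/-- `φ₂(λ)`. -/
def phi₂ (Y l : K) : K :=
  l * (l ^ 2 - (8 * Y + 1) * l - 32 * Y ^ 2 - 8 * Y)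
    / (2 * Y * (l ^ 2 + 12 * Y * l + 32 * Y ^ 2))

/-- `φ₃(λ)`. -/
def phi₃ (Y l : K) : K :=
  2 * (l ^ 2 - 8 * Y * l - 32 * Y ^ 2) / (l ^ 2 + 12 * Y * l + 32 * Y ^ 2)

/-- The matrix `N` with columns `(φ₁(λᵢ), φ₂(λᵢ), φ₃(λᵢ), 1)`. -/
def transitionN (Y : K) (l : Fin 4 → K) : Matrix (Fin 4) (Fin 4) K :=
  Matrix.of fun i j => ![phi₁ Y (l j), phi₂ Y (l j), phi₃ Y (l j), 1] i

end Radicals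

/-!
The combinatorial part rests on the following observation. A rotation system of `Dₙ₊₁` consists of
a rotation system of `Dₙ`, a corner of it at each of the vertices `a, c, d` of `Sₙ`, into which the
new edges are inserted, and one of two rotations at the new vertex `b`
(`DartExtension.extend_bijective`, `PieceModel.extendEquiv`). Face tracing in `Dₙ₊₁` arises from
face tracing in `Dₙ` and from face tracing on the new darts by splicing them together at the three
corners (`DartExtension.isGlue_face`). Hence the only information on the old embedding that matters
for the facial walks through new darts is the first-return map of its face tracing to the three
corners: a permutation of three points, called the state. It determines, together with the rotation
at `b`, the change of the number of facial walks, hence of the genus (`PieceModel.genus_extend`),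
and the type of the new embedding (`PieceModel.hasType_extend`); and if corners of the new embedding
are chosen, it determines the new state (`PieceModel.isReturn_cornerEquiv`). For six states and two
rotations all this is a finite computation, which is left to `decide` for both families.

So the distribution of the types is a linear image of the distribution of the states, and the latter
obeys a linear recursion with a `6 × 6` matrix. The four linear forms that yield the reduced
distribution span a subspace that is invariant under this recursion, which acts on it by the matrix
`Q̂` (`stateTransfer_reducedWeight`).

The algebraic part is Ferrari's solution of the quartic equation: `w ^ 2` is a root of the cubic
resolvent (`resolvent_eq_zero`), so that the four expressions in radicals, grouped in two pairs,
have the right elementary symmetric functions (`Radicals.charpoly_eq`). The roots are distinct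
because the discriminant is, up to a constant, `Y ^ 7` times the cubic polynomial in `Y` that is
supposed not to vanish (`discr_eq_zero_of_double_root`). The constant term of the resolvent is a
multiple of the square of `2304 * Y ^ 2 + 112 * Y + 1`; if this does not vanish, then `w ≠ 0`.
-/

open Equiv (Perm)

/-! ### First-return maps -/

theorem sameCycle_induction {A : Type} {φ : Perm A} {r : A → A → Prop} (hr : Equivalence r)
    (h : ∀ a, r a (φ a)) {a b : A} (hab : φ.SameCycle a b) : r a b := by
  obtain ⟨n, rfl⟩ := hab
  induction n using Int.induction_on with
  | zero => exact hr.refl _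
  | succ i ih =>
    refine hr.trans ih ?_
    rw [add_comm, zpow_add, zpow_one, Equiv.Perm.mul_apply]
    exact h _
  | pred i ih =>
    refine hr.trans ih (hr.symm ?_)
    have := h ((φ ^ (-(i : ℤ) - 1)) a)
    rwa [← Equiv.Perm.mul_apply, ← zpow_one_add, add_sub_cancel] at this

/-- `π` is the first-return map of `φ` to the points `j m`. The function `h` in the definition tells
which of these points is met first when one starts at a given point and applies `φ` repeatedly (if
there is one). On a finite set its existence forces `π` to be the first-return map
(`IsReturn.exists_iterate`), and in this form first-return maps are easy to glue and to compose. -/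
def IsReturn {A M : Type} (φ : A → A) (j : M → A) (π : M → M) : Prop :=
  ∃ h : A → Option M, (∀ m, h (j m) = some m) ∧ (∀ a, a ∉ Set.range j → h (φ a) = h a) ∧
    ∀ m, h (φ (j m)) = some (π m)

namespace IsReturn

variable {A M I : Type} {φ : Perm A} {j : M → A} {π : M → M}

theorem injective {φ : A → A} (H : IsReturn φ j π) : Function.Injective j := by
  obtain ⟨h, h1, -, -⟩ := H
  intro m m' e
  have := congrArg h e
  rwa [h1, h1, Option.some.injEq] at this

theorem trans {φ : A → A} {y : I → M} {ρ : I → I} (H : IsReturn φ j π) (H' : IsReturn π y ρ) :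
    IsReturn φ (fun i => j (y i)) ρ := by
  obtain ⟨h, h1, h2, h3⟩ := H
  obtain ⟨g, g1, g2, g3⟩ := H'
  refine ⟨fun a => (h a).bind g, fun i => by simp [h1, g1], fun a ha => ?_,
    fun i => by simp [h3, g3]⟩
  by_cases haj : a ∈ Set.range j
  · obtain ⟨m, rfl⟩ := haj
    have hm : m ∉ Set.range y := by
      rintro ⟨i, rfl⟩
      exact ha ⟨i, rfl⟩
    simp [h1, h3, g2 m hm]
  · simp [h2 a haj]

theorem exists_iterate [Finite A] (H : IsReturn φ j π) (m : M) :
    ∃ k, φ^[k + 1] (j m) = j (π m) ∧ ∀ i < k, φ^[i + 1] (j m) ∉ Set.range j := by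
  classical
  obtain ⟨h, h1, h2, h3⟩ := H
  have hex : ∃ k, φ^[k + 1] (j m) ∈ Set.range j := by
    obtain ⟨p, hp, hp'⟩ := φ.injective.mem_periodicPts (j m)
    refine ⟨p - 1, m, ?_⟩
    rw [Nat.sub_add_cancel hp]
    exact hp'.symm
  have hlt : ∀ i < Nat.find hex, φ^[i + 1] (j m) ∉ Set.range j := fun i hi => Nat.find_min hex hi
  have hval : ∀ i ≤ Nat.find hex, h (φ^[i + 1] (j m)) = some (π m) := by
    intro i
    induction i with
    | zero => intro _; exact h3 m
    | succ i ih =>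
      intro hi
      rw [Function.iterate_succ_apply', h2 _ (hlt i (by omega)), ih (by omega)]
  refine ⟨Nat.find hex, ?_, hlt⟩
  obtain ⟨c, hc⟩ := Nat.find_spec hex
  have := hval _ le_rfl
  rw [← hc, h1, Option.some.injEq] at this
  rw [← hc, this]

/-- The segment of the `φ`-orbit from `j m` up to the next return. -/
theorem exists_segment [Finite A] (H : IsReturn φ j π) (m : M) :
    ∃ n, 0 < n ∧ φ^[n] (j m) = j (π m) ∧ ∀ {β : Type} (f : A → Option β),
      (∀ a, a ∉ Set.range j → f a = none) →
        (List.iterate φ (j m) n).filterMap f = (f (j m)).toList := by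
  obtain ⟨k, hk, hlt⟩ := H.exists_iterate m
  refine ⟨k + 1, k.succ_pos, hk, fun f hf => ?_⟩
  have : (List.iterate φ (φ (j m)) k).filterMap f = [] := by
    rw [List.filterMap_eq_nil_iff]
    intro a ha
    rw [List.mem_iterate] at ha
    obtain ⟨i, hi, rfl⟩ := ha
    refine hf _ ?_
    rw [← Function.iterate_succ_apply]
    exact hlt i hi
  rw [List.iterate, List.filterMap_cons, this]
  cases f (j m) <;> rfl

theorem exists_walk [Finite A] (H : IsReturn φ j π) (m : M) (k : ℕ) :
    ∃ n, k ≤ n ∧ φ^[n] (j m) = j (π^[k] m) ∧ ∀ {β : Type} (f : A → Option β),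
      (∀ a, a ∉ Set.range j → f a = none) →
        (List.iterate φ (j m) n).filterMap f =
          (List.iterate π m k).filterMap (fun m => f (j m)) := by
  induction k generalizing m with
  | zero => exact ⟨0, le_rfl, rfl, fun f _ => rfl⟩
  | succ k ih =>
    obtain ⟨n, hn, h1, h2⟩ := H.exists_segment m
    obtain ⟨n', hn', h1', h2'⟩ := ih (π m)
    refine ⟨n + n', by omega, ?_, fun f hf => ?_⟩
    · rw [add_comm, Function.iterate_add_apply, h1, h1', Function.iterate_succ_apply]
    · rw [List.iterate_add, List.filterMap_append, h2 f hf, h1, h2' f hf, List.iterate,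
        List.filterMap_cons]
      cases f (j m) <;> rfl

/-- Traversing the `φ`-orbit of `j m` meets the points of `j` in the order in which they occur
in the `π`-orbit of `m`. -/
theorem cycleFilterMap_periodicOrbit [Finite A] (H : IsReturn φ j π) {m : M} {k : ℕ} (hk : 0 < k)
    (hm : π^[k] m = m) (hnd : (List.iterate π m k).Nodup) {β : Type} (f : A → Option β)
    (hf : ∀ a, a ∉ Set.range j → f a = none) :
    cycleFilterMap f (Function.periodicOrbit φ (j m)) =
      ((List.iterate π m k).filterMap (fun m => f (j m)) : List β) := by
  classical
  obtain ⟨n, hn, h1, h2⟩ := H.exists_walk m k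
  rw [hm] at h1
  have hn0 : 0 < n := by omega
  have hper : Function.IsPeriodicPt φ n (j m) := h1
  have hmin : Function.minimalPeriod φ (j m) = n := by
    refine le_antisymm (hper.minimalPeriod_le hn0) ?_
    by_contra! hlt
    set p := Function.minimalPeriod φ (j m) with hp
    have hp0 : 0 < p := hper.minimalPeriod_pos hn0
    have hpp : φ^[p] (j m) = j m := Function.isPeriodicPt_minimalPeriod _ _
    -- the partial inverse of `j` recovers the `π`-orbit, which would contain `m` twice
    set f₀ : A → Option M := Function.partialInv j
    have hf₀ : ∀ m, f₀ (j m) = some m := Function.partialInv_left H.injective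
    have hf₀' : ∀ a, a ∉ Set.range j → f₀ a = none := by
      intro a ha
      rcases h : f₀ a with _ | b
      · rfl
      · exact absurd ⟨b, (H.injective.isPartialInv _ _).1 h⟩ ha
    have := h2 f₀ hf₀'
    have hs : (List.iterate π m k).filterMap (fun m => f₀ (j m)) = List.iterate π m k := by
      rw [show (fun m => f₀ (j m)) = some from funext hf₀, List.filterMap_some]
    rw [hs] at this
    rw [← this] at hnd
    obtain ⟨q, rfl⟩ : ∃ q, n = p + (q + 1) := ⟨n - p - 1, by omega⟩
    rw [List.iterate_add, hpp, List.filterMap_append] at hnd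
    obtain ⟨p', hp'⟩ : ∃ p', p = p' + 1 := ⟨p - 1, by omega⟩
    have hd := List.disjoint_of_nodup_append hnd
    rw [hp'] at hd
    refine hd (a := m) ?_ ?_ <;> simp [List.iterate, hf₀]
  rw [Function.periodicOrbit, hmin, List.range_map_iterate, ← h2 f hf]
  rfl

theorem sameCycle [Finite A] (H : IsReturn φ j π) (m : M) (k : ℕ) :
    φ.SameCycle (j m) (j (π^[k] m)) := by
  obtain ⟨n, -, h, -⟩ := H.exists_walk m k
  exact ⟨n, by rw [← h, zpow_natCast, ← Equiv.Perm.iterate_eq_pow]⟩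

end IsReturn

/-! ### Counting cycles by their first returns -/

/-- The list `reps` describes the cycles of `π`: each cycle is given by one of its points and by its
length. -/
structure IsCycleList {M : Type} (π : M → M) (reps : List (M × ℕ)) : Prop where
  inj : Function.Injective π
  pos : ∀ r ∈ reps, 0 < r.2 ∧ π^[r.2] r.1 = r.1
  nodup : (reps.flatMap fun r => List.iterate π r.1 r.2).Nodup
  cover : ∀ m, ∃ r ∈ reps, m ∈ List.iterate π r.1 r.2

/-- The number of cycles of `φ` that contain none of the points `j m`. -/
noncomputable def cardAvoiding {A M : Type} (φ : Perm A) (j : M → A) : ℕ :=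
  Nat.card {q : Quotient (Equiv.Perm.SameCycle.setoid φ) // ∀ m, q ≠ Quotient.mk _ (j m)}

theorem mem_iterate_map_iff {M : Type} {π : M → M} (hπ : Function.Injective π) {m₀ : M} {k : ℕ}
    (hk : 0 < k) (h : π^[k] m₀ = m₀) (m : M) :
    π m ∈ List.iterate π m₀ k ↔ m ∈ List.iterate π m₀ k := by
  simp only [List.mem_iterate]
  constructor
  · rintro ⟨_ | i, hi, e⟩
    · refine ⟨k - 1, by omega, hπ ?_⟩
      rw [e, ← Function.iterate_succ_apply' π, Nat.succ_eq_add_one, Nat.sub_add_cancel hk, h]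
      rfl
    · exact ⟨i, by omega, hπ (by rw [e, Function.iterate_succ_apply'])⟩
  · rintro ⟨i, hi, rfl⟩
    rcases Nat.lt_or_ge (i + 1) k with h' | h'
    · exact ⟨i + 1, h', (Function.iterate_succ_apply' _ _ _).symm⟩
    · obtain rfl : k = i + 1 := by omega
      exact ⟨0, hk, by rw [← Function.iterate_succ_apply' π, h]; rfl⟩

namespace IsReturn

variable {A M : Type} {φ : Perm A} {j : M → A} {π : M → M} {reps : List (M × ℕ)}

theorem cycle_injective (H : IsReturn φ j π) (hr : IsCycleList π reps) :
    Function.Injective fun i : Fin reps.length =>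
      (Quotient.mk (Equiv.Perm.SameCycle.setoid φ) (j (reps.get i).1)) := by
  obtain ⟨h, h1, h2, h3⟩ := H
  intro i k hik
  have hs : φ.SameCycle (j (reps.get i).1) (j (reps.get k).1) := Quotient.exact hik
  have key := sameCycle_induction
    (r := fun a b => ∀ r ∈ reps, (∃ m, h a = some m ∧ m ∈ List.iterate π r.1 r.2) ↔
      (∃ m, h b = some m ∧ m ∈ List.iterate π r.1 r.2))
    ⟨fun a r _ => Iff.rfl, fun h r hr => (h r hr).symm, fun h h' r hr => (h r hr).trans (h' r hr)⟩
    (fun a r hrm => by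
      by_cases ha : a ∈ Set.range j
      · obtain ⟨m, rfl⟩ := ha
        simp only [h1, h3, Option.some.injEq, exists_eq_left']
        exact (mem_iterate_map_iff hr.inj (hr.pos r hrm).1 (hr.pos r hrm).2 m).symm
      · rw [h2 a ha]) hs
  simp only [h1, Option.some.injEq, exists_eq_left'] at key
  have hself : ∀ i : Fin reps.length,
      (reps.get i).1 ∈ List.iterate π (reps.get i).1 (reps.get i).2 := fun i =>
    List.mem_iterate.2 ⟨0, (hr.pos _ (List.get_mem _ _)).1, rfl⟩
  have hmem := (key (reps.get i) (List.get_mem _ _)).1 (hself i)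
  have hpw := (List.nodup_flatMap.1 hr.nodup).2
  rw [List.pairwise_iff_get] at hpw
  rcases lt_trichotomy i k with hlt | heq | hlt
  · exact absurd (hself k) (hpw i k hlt hmem)
  · exact heq
  · exact absurd hmem (hpw k i hlt (hself k))

theorem exists_cycle [Finite A] (H : IsReturn φ j π) (hr : IsCycleList π reps) (m : M) :
    ∃ i : Fin reps.length, Quotient.mk (Equiv.Perm.SameCycle.setoid φ) (j (reps.get i).1) =
      Quotient.mk _ (j m) := by
  obtain ⟨r, hrm, hm⟩ := hr.cover m
  obtain ⟨i, rfl⟩ := List.get_of_mem hrm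
  obtain ⟨k, -, rfl⟩ := List.mem_iterate.1 hm
  exact ⟨i, Quotient.sound (H.sameCycle _ k)⟩

theorem card_cycles [Finite A] (H : IsReturn φ j π) (hr : IsCycleList π reps) :
    Nat.card (Quotient (Equiv.Perm.SameCycle.setoid φ)) = reps.length + cardAvoiding φ j := by
  classical
  have e : Fin reps.length ≃ {q : Quotient (Equiv.Perm.SameCycle.setoid φ) //
      ¬ ∀ m, q ≠ Quotient.mk _ (j m)} :=
    Equiv.ofBijective (fun i => ⟨Quotient.mk _ (j (reps.get i).1), fun h => h _ rfl⟩)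
      ⟨fun i k h => H.cycle_injective hr (congrArg Subtype.val h), by
        rintro ⟨q, hq⟩
        push Not at hq
        obtain ⟨m, rfl⟩ := hq
        obtain ⟨i, hi⟩ := H.exists_cycle hr m
        exact ⟨i, Subtype.ext hi⟩⟩
  rw [cardAvoiding, ← Nat.card_congr (Equiv.sumCompl fun q => ∀ m, q ≠ Quotient.mk _ (j m)),
    Nat.card_sum, ← Nat.card_congr e, Nat.card_fin, add_comm]

theorem card_cycles_eq_count [Finite A] {β : Type} [DecidableEq β] (H : IsReturn φ j π)
    (hr : IsCycleList π reps) (f : A → Option β) (hf : ∀ a, a ∉ Set.range j → f a = none)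
    (T : Quotient (Equiv.Perm.SameCycle.setoid φ) → Cycle β)
    (hT : ∀ a, T (Quotient.mk _ a) = cycleFilterMap f (Function.periodicOrbit φ a))
    {c : Cycle β} (hc : c ≠ Cycle.nil) :
    Nat.card {q // T q = c} = (Multiset.map (fun r : M × ℕ =>
      (((List.iterate π r.1 r.2).filterMap fun m => f (j m) : List β) : Cycle β))
        (reps : Multiset (M × ℕ))).count c := by
  classical
  set ty : M × ℕ → Cycle β := fun r =>
    (((List.iterate π r.1 r.2).filterMap fun m => f (j m) : List β) : Cycle β) with hty
  have hTj : ∀ i : Fin reps.length, T (Quotient.mk _ (j (reps.get i).1)) = ty (reps.get i) := by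
    intro i
    have hi := hr.pos _ (List.get_mem reps i)
    rw [hT, H.cycleFilterMap_periodicOrbit hi.1 hi.2
      ((List.nodup_flatMap.1 hr.nodup).1 _ (List.get_mem reps i)) f hf]
  have e : {i : Fin reps.length // ty (reps.get i) = c} ≃
      {q : Quotient (Equiv.Perm.SameCycle.setoid φ) // T q = c} :=
    Equiv.ofBijective (fun i => ⟨Quotient.mk _ (j (reps.get i.1).1), (hTj i.1).trans i.2⟩)
      ⟨fun i k h => Subtype.ext (H.cycle_injective hr (congrArg Subtype.val h)), by
        rintro ⟨q, hq⟩
        obtain ⟨a, rfl⟩ := Quotient.exists_rep q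
        have hm : ∃ m, φ.SameCycle a (j m) := by
          by_contra! hno
          refine hc ?_
          rw [← hq, hT, Function.periodicOrbit]
          change ((List.filterMap f _ : List β) : Cycle β) = _
          rw [List.filterMap_eq_nil_iff.2]
          · rfl
          intro b hb
          simp only [List.mem_map, List.mem_range] at hb
          obtain ⟨n, -, rfl⟩ := hb
          refine hf _ ?_
          rintro ⟨m, hm⟩
          refine hno m ⟨n, ?_⟩
          rw [zpow_natCast, ← Equiv.Perm.iterate_eq_pow, hm]
        obtain ⟨m, hm⟩ := hm
        obtain ⟨i, hi⟩ := H.exists_cycle hr m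
        have hi' := hi.trans (Quotient.sound hm).symm
        exact ⟨⟨i, by rw [← hTj, hi', hq]⟩, Subtype.ext hi'⟩⟩
  rw [← Nat.card_congr e, Nat.card_eq_fintype_card, Fintype.card_subtype]
  have : (Multiset.map ty (reps : Multiset (M × ℕ))) =
      (Finset.univ : Finset (Fin reps.length)).val.map fun i => ty (reps.get i) := by
    rw [Fin.univ_val_map, ← Function.comp_def ty, ← List.map_ofFn, List.ofFn_get]
    rfl
  rw [this, Multiset.count_map]
  simp only [Finset.card, Finset.filter, eq_comm]

end IsReturn

/-! ### Splicing two permutations -/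

/-- `φ'` arises from `φ` and the self-map `ψ` of `M` by splicing them together at the pairs
`x i`, `e i`: an arrow of `φ` into `x i` is redirected to `e i`, and an arrow of `ψ` into `e i` is
redirected to `x i`. -/
structure IsGlue {D M A I : Type} (φ : Perm D) (φ' : Perm A) (E : D ⊕ M ≃ A) (x : I → D)
    (e : I → M) (ψ : M → M) : Prop where
  inl_eq : ∀ d i, φ d = x i → φ' (E (Sum.inl d)) = E (Sum.inr (e i))
  inl_ne : ∀ d, (∀ i, φ d ≠ x i) → φ' (E (Sum.inl d)) = E (Sum.inl (φ d))
  inr_eq : ∀ m i, ψ m = e i → φ' (E (Sum.inr m)) = E (Sum.inl (x i))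
  inr_ne : ∀ m, (∀ i, ψ m ≠ e i) → φ' (E (Sum.inr m)) = E (Sum.inr (ψ m))

namespace IsGlue

variable {D M A I : Type} {φ : Perm D} {φ' : Perm A} {E : D ⊕ M ≃ A} {x : I → D} {e : I → M}
  {ψ : M → M}

/-- The first return to `M` after splicing only depends on the first-return map `ρ` of `φ` to the
points `x i`. -/
theorem isReturn (G : IsGlue φ φ' E x e ψ) {ρ : I → I} (H : IsReturn φ x ρ) {π : M → M}
    (hπ : ∀ m i, ψ m = e i → π m = e (ρ i)) (hπ' : ∀ m, (∀ i, ψ m ≠ e i) → π m = ψ m) :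
    IsReturn φ' (fun m => E (Sum.inr m)) π := by
  obtain ⟨h, h1, h2, h3⟩ := H
  refine ⟨fun a => Sum.elim (fun d => (h (φ d)).map e) some (E.symm a), fun m => by simp, ?_, ?_⟩
  · intro a ha
    obtain ⟨u, rfl⟩ := E.surjective a
    rcases u with d | m
    · by_cases hd : ∃ i, φ d = x i
      · obtain ⟨i, hi⟩ := hd
        simp [G.inl_eq d i hi, hi, h1]
      · push Not at hd
        simp only [G.inl_ne d hd, Equiv.symm_apply_apply, Sum.elim_inl]
        rw [h2 (φ d)]
        rintro ⟨i, hi⟩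
        exact hd i hi.symm
    · exact absurd ⟨m, rfl⟩ ha
  · intro m
    by_cases hm : ∃ i, ψ m = e i
    · obtain ⟨i, hi⟩ := hm
      simp [G.inr_eq m i hi, h3, hπ m i hi]
    · push Not at hm
      simp [G.inr_ne m hm, hπ' m hm]

theorem sameCycle_inl (G : IsGlue φ φ' E x e ψ) [Finite D] {a b : D}
    (ha : ∀ i, ¬ φ.SameCycle a (x i)) (hab : φ.SameCycle a b) :
    φ'.SameCycle (E (Sum.inl a)) (E (Sum.inl b)) := by
  obtain ⟨n, -, rfl⟩ := hab.exists_pow_eq'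
  refine ⟨n, ?_⟩
  rw [zpow_natCast]
  clear hab
  induction n with
  | zero => rfl
  | succ n ih =>
    rw [pow_succ', Equiv.Perm.mul_apply, ih, G.inl_ne, pow_succ', Equiv.Perm.mul_apply]
    intro i hi
    refine ha i ⟨(n + 1 : ℕ), ?_⟩
    rw [zpow_natCast, pow_succ', Equiv.Perm.mul_apply, hi]

theorem exists_inl_of_sameCycle (G : IsGlue φ φ' E x e ψ) [Finite A] {a : D}
    (ha : ∀ i, ¬ φ.SameCycle a (x i)) {u : A} (hu : φ'.SameCycle (E (Sum.inl a)) u) :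
    ∃ b, u = E (Sum.inl b) ∧ φ.SameCycle a b := by
  obtain ⟨n, -, rfl⟩ := hu.exists_pow_eq'
  clear hu
  induction n with
  | zero => exact ⟨a, rfl, Equiv.Perm.SameCycle.refl _ _⟩
  | succ n ih =>
    obtain ⟨b, hb, hab⟩ := ih
    have hab' : φ.SameCycle a (φ b) := Equiv.Perm.sameCycle_apply_right.2 hab
    refine ⟨φ b, ?_, hab'⟩
    rw [pow_succ', Equiv.Perm.mul_apply, hb, G.inl_ne]
    intro i hi
    exact ha i (hi ▸ hab')

theorem exists_inr_of_sameCycle (G : IsGlue φ φ' E x e ψ) [Finite D] (hψ : ∀ i, ∃ m, ψ m = e i)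
    {a : D} {i : I} (h : φ.SameCycle a (x i)) :
    ∃ m, φ'.SameCycle (E (Sum.inl a)) (E (Sum.inr m)) := by
  obtain ⟨n, -, hn⟩ := h.exists_pow_eq'
  clear h
  induction n generalizing a with
  | zero =>
    obtain rfl : a = x i := hn
    obtain ⟨m, hm⟩ := hψ i
    refine ⟨m, ?_⟩
    rw [← G.inr_eq m i hm, Equiv.Perm.sameCycle_apply_left]
  | succ n ih =>
    by_cases hd : ∃ i, φ a = x i
    · obtain ⟨k, hk⟩ := hd
      refine ⟨e k, ?_⟩
      rw [← G.inl_eq a k hk, Equiv.Perm.sameCycle_apply_right]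
    · push Not at hd
      obtain ⟨m, hm⟩ := ih (a := φ a) (by rw [← hn, pow_succ, Equiv.Perm.mul_apply])
      refine ⟨m, ?_⟩
      rwa [← G.inl_ne a hd, Equiv.Perm.sameCycle_apply_left] at hm

/-- The cycles of `φ` through none of the points `x i` are exactly the cycles of the spliced
permutation that do not meet `M`. -/
theorem cardAvoiding_eq (G : IsGlue φ φ' E x e ψ) [Finite D] [Finite A]
    (hψ : ∀ i, ∃ m, ψ m = e i) :
    cardAvoiding φ' (fun m => E (Sum.inr m)) = cardAvoiding φ x := by
  have hout : ∀ q : {q : Quotient (Equiv.Perm.SameCycle.setoid φ) // ∀ i, q ≠ Quotient.mk _ (x i)},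
      ∀ i, ¬ φ.SameCycle q.1.out (x i) := by
    intro q i hi
    refine q.2 i ?_
    rw [← Quotient.out_eq q.1]
    exact Quotient.sound hi
  symm
  refine Nat.card_congr (Equiv.ofBijective
    (fun q => ⟨Quotient.mk _ (E (Sum.inl q.1.out)), fun m hm => ?_⟩) ⟨fun q q' h => ?_, ?_⟩)
  · obtain ⟨b, hb, -⟩ := G.exists_inl_of_sameCycle (hout q) (Quotient.exact hm)
    simpa using E.injective hb
  · obtain ⟨b, hb, hs⟩ := G.exists_inl_of_sameCycle (hout q)
      (Quotient.exact (congrArg Subtype.val h))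
    obtain rfl : q'.1.out = b := by simpa using E.injective hb
    refine Subtype.ext ?_
    rw [← Quotient.out_eq q.1, ← Quotient.out_eq q'.1]
    exact Quotient.sound hs
  · rintro ⟨q', hq'⟩
    obtain ⟨a, rfl⟩ := Quotient.exists_rep q'
    obtain ⟨u, rfl⟩ := E.surjective a
    rcases u with d | m
    · have hd : ∀ i, ¬ φ.SameCycle d (x i) := by
        intro i hi
        obtain ⟨m, hm⟩ := G.exists_inr_of_sameCycle hψ hi
        exact hq' m (Quotient.sound hm)
      refine ⟨⟨Quotient.mk _ d, fun i hi => hd i (Quotient.exact hi)⟩, Subtype.ext ?_⟩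
      refine Quotient.sound ?_
      refine (G.sameCycle_inl hd ?_).symm
      exact Quotient.exact (Quotient.out_eq (Quotient.mk (Equiv.Perm.SameCycle.setoid φ) d)).symm
    · exact absurd rfl (hq' m)

end IsGlue

/-! ### Inserting darts into a rotation system -/

/-- The permutation `σ` of a set of darts is a rotation system, where `v` is the map that sends a
dart to its initial vertex. -/
def IsRot {A V : Type} (v : A → V) (σ : Perm A) : Prop :=
  (∀ a, v (σ a) = v a) ∧ ∀ a b, v a = v b → σ.SameCycle a b

section Splice

variable {D M I : Type}

open Classical in
/-- The involution of `D ⊕ M` that exchanges `x i` and `e i` for all `i`. -/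
noncomputable def spliceSwap (x : I → D) (e : I → M) (hx : Function.Injective x)
    (he : Function.Injective e) : Perm (D ⊕ M) :=
  Function.Involutive.toPerm
    (Sum.elim (fun d => if h : ∃ i, x i = d then Sum.inr (e h.choose) else Sum.inl d)
      (fun m => if h : ∃ i, e i = m then Sum.inl (x h.choose) else Sum.inr m)) (by
    rintro (d | m)
    · by_cases h : ∃ i, x i = d
      · have h' : ∃ i, e i = e h.choose := ⟨_, rfl⟩
        simp [h, he h'.choose_spec, h.choose_spec]
      · simp [h]
    · by_cases h : ∃ i, e i = m
      · have h' : ∃ i, x i = x h.choose := ⟨_, rfl⟩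
        simp [h, hx h'.choose_spec, h.choose_spec]
      · simp [h])

variable {x : I → D} {e : I → M} (hx : Function.Injective x) (he : Function.Injective e)

theorem spliceSwap_spliceSwap (u : D ⊕ M) :
    spliceSwap x e hx he (spliceSwap x e hx he u) = u :=
  (spliceSwap x e hx he).left_inv u

theorem spliceSwap_inl (i : I) : spliceSwap x e hx he (Sum.inl (x i)) = Sum.inr (e i) := by
  have h : ∃ k, x k = x i := ⟨i, rfl⟩
  exact (dif_pos h).trans (by rw [hx h.choose_spec])

theorem spliceSwap_inr (i : I) : spliceSwap x e hx he (Sum.inr (e i)) = Sum.inl (x i) := by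
  rw [← spliceSwap_inl hx he, spliceSwap_spliceSwap]

theorem spliceSwap_inl_of_ne {d : D} (h : ∀ i, d ≠ x i) :
    spliceSwap x e hx he (Sum.inl d) = Sum.inl d := by
  exact dif_neg (not_exists.2 fun i => (h i).symm)

theorem spliceSwap_inr_of_ne {m : M} (h : ∀ i, m ≠ e i) :
    spliceSwap x e hx he (Sum.inr m) = Sum.inr m := by
  exact dif_neg (not_exists.2 fun i => (h i).symm)

theorem spliceSwap_of_ne {u : D ⊕ M} (h : ∀ i, u ≠ Sum.inl (x i)) (h' : ∀ i, u ≠ Sum.inr (e i)) :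
    spliceSwap x e hx he u = u := by
  rcases u with d | m
  · exact spliceSwap_inl_of_ne hx he fun i hi => h i (congrArg _ hi)
  · exact spliceSwap_inr_of_ne hx he fun i hi => h' i (congrArg _ hi)

open Classical in
/-- The map that collapses each `e i` to the point `x i` behind which it is inserted. -/
noncomputable def collapse (x : I → D) (e : I → M) (hx : Function.Injective x)
    (he : Function.Injective e) (u : D ⊕ M) : D ⊕ M :=
  if ∃ i, u = Sum.inr (e i) then spliceSwap x e hx he u else u

theorem collapse_inr (i : I) : collapse x e hx he (Sum.inr (e i)) = Sum.inl (x i) := by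
  rw [collapse, if_pos ⟨i, rfl⟩, spliceSwap_inr]

theorem collapse_of_ne {u : D ⊕ M} (h : ∀ i, u ≠ Sum.inr (e i)) : collapse x e hx he u = u := by
  rw [collapse, if_neg (by simpa using h)]

theorem collapse_inl (d : D) : collapse x e hx he (Sum.inl d) = Sum.inl d :=
  collapse_of_ne hx he (by simp)

variable {κ : Perm (D ⊕ M)} (hκ : ∀ i, κ (Sum.inr (e i)) = Sum.inr (e i))

include hκ in
theorem sameCycle_splice {u w : D ⊕ M} (h : κ.SameCycle u w) :
    (spliceSwap x e hx he * κ).SameCycle u w := by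
  refine sameCycle_induction ⟨Equiv.Perm.SameCycle.refl _, fun h => h.symm, fun h h' => h.trans h'⟩
    (fun u => ?_) h
  by_cases h1 : ∃ i, κ u = Sum.inl (x i)
  · obtain ⟨i, hi⟩ := h1
    refine ⟨2, ?_⟩
    rw [zpow_ofNat, pow_two]
    simp only [Equiv.Perm.mul_apply, hi, spliceSwap_inl, hκ, spliceSwap_inr]
  · push Not at h1
    by_cases h2 : ∃ i, κ u = Sum.inr (e i)
    · obtain ⟨i, hi⟩ := h2
      rw [← hκ i] at hi
      rw [κ.injective hi, hκ]
    · push Not at h2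
      refine ⟨1, ?_⟩
      rw [zpow_one, Equiv.Perm.mul_apply, spliceSwap_of_ne hx he h1 h2]

include hκ in
theorem sameCycle_of_splice {u w : D ⊕ M} (h : (spliceSwap x e hx he * κ).SameCycle u w) :
    κ.SameCycle (collapse x e hx he u) (collapse x e hx he w) := by
  refine sameCycle_induction
    (r := fun u w => κ.SameCycle (collapse x e hx he u) (collapse x e hx he w))
    ⟨fun _ => Equiv.Perm.SameCycle.refl _ _, fun h => h.symm, fun h h' => h.trans h'⟩
    (fun u => ?_) h
  rw [Equiv.Perm.mul_apply]
  by_cases h0 : ∃ i, u = Sum.inr (e i)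
  · obtain ⟨i, rfl⟩ := h0
    rw [hκ, spliceSwap_inr, collapse_inr, collapse_inl]
  push Not at h0
  rw [collapse_of_ne hx he h0]
  have h2 : ∀ i, κ u ≠ Sum.inr (e i) := by
    intro i hi
    rw [← hκ i] at hi
    exact h0 i (κ.injective hi)
  refine (Equiv.Perm.sameCycle_apply_right.2 (Equiv.Perm.SameCycle.refl κ u)).trans ?_
  by_cases h1 : ∃ i, κ u = Sum.inl (x i)
  · obtain ⟨i, hi⟩ := h1
    rw [hi, spliceSwap_inl, collapse_inr]
  · push Not at h1
    rw [spliceSwap_of_ne hx he h1 h2, collapse_of_ne hx he h2]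

theorem sumCongr_zpow (σ : Perm D) (ν : Perm M) (n : ℤ) :
    (Equiv.Perm.sumCongr σ ν) ^ n = Equiv.Perm.sumCongr (σ ^ n) (ν ^ n) :=
  (map_zpow (Equiv.Perm.sumCongrHom D M) (σ, ν) n).symm

theorem sameCycle_sumCongr_inl {σ : Perm D} {ν : Perm M} {a b : D} :
    (Equiv.Perm.sumCongr σ ν).SameCycle (Sum.inl a) (Sum.inl b) ↔ σ.SameCycle a b := by
  simp [Equiv.Perm.SameCycle, sumCongr_zpow]

theorem sameCycle_sumCongr_inr {σ : Perm D} {ν : Perm M} {a b : M} :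
    (Equiv.Perm.sumCongr σ ν).SameCycle (Sum.inr a) (Sum.inr b) ↔ ν.SameCycle a b := by
  simp [Equiv.Perm.SameCycle, sumCongr_zpow]

variable {V : Type} {vD : D → V} {vM : M → V}

theorem spliceSwap_vertex (hxe : ∀ i, vD (x i) = vM (e i)) (u : D ⊕ M) :
    Sum.elim vD vM (spliceSwap x e hx he u) = Sum.elim vD vM u := by
  by_cases h1 : ∃ i, u = Sum.inl (x i)
  · obtain ⟨i, rfl⟩ := h1
    simp [spliceSwap_inl, hxe]
  by_cases h2 : ∃ i, u = Sum.inr (e i)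
  · obtain ⟨i, rfl⟩ := h2
    simp [spliceSwap_inr, hxe]
  push Not at h1 h2
  rw [spliceSwap_of_ne hx he h1 h2]

/-- Inserting each dart `e i` in front of the dart `x i` at the same vertex turns rotation systems
into a rotation system. -/
theorem IsRot.splice (hxe : ∀ i, vD (x i) = vM (e i))
    (hsep : ∀ d m, vM m = vD d → ∃ i, m = e i) {σ : Perm D} {ν : Perm M} (hσ : IsRot vD σ)
    (hν : IsRot vM ν) (hνe : ∀ i, ν (e i) = e i) :
    IsRot (Sum.elim vD vM) (spliceSwap x e hx he * Equiv.Perm.sumCongr σ ν) := by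
  have hκ : ∀ i, Equiv.Perm.sumCongr σ ν (Sum.inr (e i)) = Sum.inr (e i) := by simp [hνe]
  refine ⟨fun u => ?_, ?_⟩
  · rw [Equiv.Perm.mul_apply, spliceSwap_vertex hx he hxe]
    rcases u with d | m
    · simp [hσ.1]
    · simp [hν.1]
  · -- each `e i` may be replaced by the dart `x i` at the same vertex
    have hcoll : ∀ u, (spliceSwap x e hx he * Equiv.Perm.sumCongr σ ν).SameCycle u
        (collapse x e hx he u) ∧
        Sum.elim vD vM (collapse x e hx he u) = Sum.elim vD vM u ∧
        ∀ i, collapse x e hx he u ≠ Sum.inr (e i) := by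
      intro u
      by_cases h : ∃ i, u = Sum.inr (e i)
      · obtain ⟨i, rfl⟩ := h
        rw [collapse_inr]
        refine ⟨⟨1, ?_⟩, by simp [hxe], by simp⟩
        rw [zpow_one, Equiv.Perm.mul_apply, hκ, spliceSwap_inr]
      · push Not at h
        rw [collapse_of_ne hx he h]
        exact ⟨Equiv.Perm.SameCycle.refl _ _, rfl, h⟩
    intro u w huw
    obtain ⟨u1, u2, u3⟩ := hcoll u
    obtain ⟨w1, w2, w3⟩ := hcoll w
    refine u1.trans (Equiv.Perm.SameCycle.trans ?_ w1.symm)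
    rw [← u2, ← w2] at huw
    refine sameCycle_splice hx he hκ ?_
    revert huw u3 w3
    rcases collapse x e hx he u with d | m <;> rcases collapse x e hx he w with d' | m' <;>
      intro huw u3 w3
    · exact sameCycle_sumCongr_inl.2 (hσ.2 _ _ huw)
    · obtain ⟨i, rfl⟩ := hsep d m' huw.symm
      exact absurd rfl (w3 i)
    · obtain ⟨i, rfl⟩ := hsep d' m huw
      exact absurd rfl (u3 i)
    · exact sameCycle_sumCongr_inr.2 (hν.2 _ _ huw)

/-- Every rotation system of the glued darts arises by insertion. -/
theorem IsRot.exists_splice [Finite D] [Finite M] (hve : Function.Injective fun i => vM (e i))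
    (hfoot : ∀ i, ∃ d, vD d = vM (e i)) (hsep : ∀ d m, vM m = vD d → ∃ i, m = e i)
    {τ : Perm (D ⊕ M)} (hτ : IsRot (Sum.elim vD vM) τ) :
    ∃ (x : I → D) (hx : Function.Injective x) (σ : Perm D) (ν : Perm M),
      (∀ i, vD (x i) = vM (e i)) ∧ IsRot vD σ ∧ IsRot vM ν ∧
      τ = spliceSwap x e hx he * Equiv.Perm.sumCongr σ ν := by
  have hstub : ∀ {i m}, vM m = vM (e i) → m = e i := by
    intro i m hm
    obtain ⟨d, hd⟩ := hfoot i
    obtain ⟨k, rfl⟩ := hsep d m (hm.trans hd.symm)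
    rw [hve hm]
  have hex : ∀ i, ∃ d, τ (Sum.inr (e i)) = Sum.inl d ∧ vD d = vM (e i) := by
    intro i
    obtain ⟨d, hd⟩ := hfoot i
    have hv := hτ.1 (Sum.inr (e i))
    rcases h : τ (Sum.inr (e i)) with d' | m
    · exact ⟨d', rfl, by simpa [h] using hv⟩
    · exfalso
      rw [h] at hv
      rw [hstub hv] at h
      have hs : τ.SameCycle (Sum.inr (e i)) (Sum.inl d) := hτ.2 _ _ hd.symm
      obtain ⟨n, hn⟩ := hs
      rw [Equiv.Perm.zpow_apply_eq_self_of_apply_eq_self h] at hn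
      exact Sum.inr_ne_inl hn
  choose x hx1 hx2 using hex
  have hx : Function.Injective x := fun i k h => hve (by simp only [← hx2, h])
  set κ : Perm (D ⊕ M) := spliceSwap x e hx he * τ with hκdef
  have hκτ : τ = spliceSwap x e hx he * κ := by
    ext1 u
    simp [hκdef, spliceSwap_spliceSwap]
  have hκ : ∀ i, κ (Sum.inr (e i)) = Sum.inr (e i) := by
    intro i
    rw [hκdef, Equiv.Perm.mul_apply, hx1, spliceSwap_inl]
  have hκv : ∀ u, Sum.elim vD vM (κ u) = Sum.elim vD vM u := by
    intro u
    rw [hκdef, Equiv.Perm.mul_apply, spliceSwap_vertex hx he hx2, hτ.1]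
  have hmaps : Set.MapsTo κ (Set.range Sum.inl) (Set.range Sum.inl) := by
    rintro _ ⟨d, rfl⟩
    rcases h : κ (Sum.inl d) with d' | m
    · exact ⟨d', rfl⟩
    · exfalso
      have hv := hκv (Sum.inl d)
      rw [h] at hv
      obtain ⟨i, rfl⟩ := hsep d m hv
      rw [← hκ i] at h
      exact Sum.inl_ne_inr (κ.injective h)
  obtain ⟨⟨σ, ν⟩, hσν⟩ := Equiv.Perm.mem_sumCongrHom_range_of_perm_mapsTo_inl hmaps
  have hσν' : Equiv.Perm.sumCongr σ ν = κ := hσν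
  refine ⟨x, hx, σ, ν, hx2, ⟨fun d => ?_, fun a b hab => ?_⟩, ⟨fun m => ?_, fun m m' hm => ?_⟩, ?_⟩
  · have := hκv (Sum.inl d)
    rw [← hσν'] at this
    simpa using this
  · have h := hτ.2 (Sum.inl a) (Sum.inl b) hab
    rw [hκτ] at h
    have h := sameCycle_of_splice hx he hκ h
    rwa [collapse_inl, collapse_inl, ← hσν', sameCycle_sumCongr_inl] at h
  · have := hκv (Sum.inr m)
    rw [← hσν'] at this
    simpa using this
  · by_cases hms : ∃ i, m = e i
    · obtain ⟨i, rfl⟩ := hms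
      rw [hstub hm.symm]
    by_cases hms' : ∃ i, m' = e i
    · obtain ⟨i, rfl⟩ := hms'
      rw [hstub hm]
    push Not at hms hms'
    have h := hτ.2 (Sum.inr m) (Sum.inr m') hm
    rw [hκτ] at h
    have h := sameCycle_of_splice hx he hκ h
    rwa [collapse_of_ne hx he (by simpa using hms), collapse_of_ne hx he (by simpa using hms'),
      ← hσν', sameCycle_sumCongr_inr] at h
  · rw [hσν', hκτ]

theorem splice_injective {x' : I → D} (hx' : Function.Injective x') {σ σ' : Perm D} {ν ν' : Perm M}
    (hνe : ∀ i, ν (e i) = e i) (hνe' : ∀ i, ν' (e i) = e i)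
    (h : spliceSwap x e hx he * Equiv.Perm.sumCongr σ ν =
      spliceSwap x' e hx' he * Equiv.Perm.sumCongr σ' ν') : x = x' ∧ σ = σ' ∧ ν = ν' := by
  have hxx : x = x' := by
    funext i
    have := congrArg (fun p : Perm (D ⊕ M) => p (Sum.inr (e i))) h
    simpa [hνe, hνe', spliceSwap_inr] using this
  subst hxx
  have := Equiv.Perm.sumCongrHom_injective (a₁ := (σ, ν)) (a₂ := (σ', ν')) (mul_left_cancel h)
  exact ⟨rfl, congrArg Prod.fst this, congrArg Prod.snd this⟩

end Splice

/-! ### Embeddings of a graph with additional edges -/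

namespace RotationSystem

variable {V : Type} {G : SimpleGraph V} {A : Type}

/-- The rotation system given by a permutation of a set `A` of names for the darts. -/
def ofIsRot (E : A ≃ G.Dart) (σ : Perm A) (h : IsRot (fun a => (E a).fst) σ) :
    RotationSystem G where
  rot := E.permCongr σ
  fst_rot d := by simpa using h.1 (E.symm d)
  cyclic d d' hd := by
    obtain ⟨n, hn⟩ := h.2 (E.symm d) (E.symm d') (by simpa using hd)
    refine ⟨n, ?_⟩
    have : (E.permCongr σ) ^ n = E.permCongr (σ ^ n) := (map_zpow E.permCongrHom σ n).symm
    rw [this, Equiv.permCongr_apply, hn, Equiv.apply_symm_apply]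

theorem rot_injective : Function.Injective (rot : RotationSystem G → Perm G.Dart) := by
  rintro ⟨⟩ ⟨⟩ rfl
  rfl

theorem exists_ofIsRot (E : A ≃ G.Dart) (R : RotationSystem G) :
    ∃ σ h, R = ofIsRot E σ h := by
  have key : E.permCongr (E.symm.permCongr R.rot) = R.rot := by
    ext1 d
    simp [Equiv.permCongr_apply]
  refine ⟨E.symm.permCongr R.rot, ⟨fun a => ?_, fun a b hab => ?_⟩, rot_injective key.symm⟩
  · simp [Equiv.permCongr_apply, R.fst_rot]
  · obtain ⟨n, hn⟩ := R.cyclic _ _ hab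
    refine ⟨n, ?_⟩
    have : (E.symm.permCongr R.rot) ^ n = E.symm.permCongr (R.rot ^ n) :=
      (map_zpow E.symm.permCongrHom R.rot n).symm
    rw [this, Equiv.permCongr_apply, Equiv.symm_symm, hn, Equiv.symm_apply_apply]

theorem ofIsRot_rot (E : A ≃ G.Dart) {σ : Perm A} (h : IsRot (fun a => (E a).fst) σ) (a : A) :
    (ofIsRot E σ h).rot (E a) = E (σ a) := by
  simp [ofIsRot, Equiv.permCongr_apply]

theorem ofIsRot_injective (E : A ≃ G.Dart) {σ σ' : Perm A} (h : IsRot (fun a => (E a).fst) σ)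
    (h' : IsRot (fun a => (E a).fst) σ') (e : ofIsRot E σ h = ofIsRot E σ' h') : σ = σ' :=
  E.permCongr.injective (congrArg rot e)

theorem face_apply (R : RotationSystem G) (d : G.Dart) : R.face d = R.rot d.symm := rfl

instance [Finite V] : Finite (RotationSystem G) :=
  have : Finite G.Dart := Finite.of_injective _ SimpleGraph.Dart.toProd_injective
  Finite.of_injective _ rot_injective

end RotationSystem

/-- A rotation system of `G` together with a choice of a dart `x i` at each of the vertices
`foot i`. The dart stands for the corner in front of it, into which a new edge can be inserted. -/
def Cornered {V I : Type} (G : SimpleGraph V) (foot : I → V) : Type :=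
  {p : RotationSystem G × (I → G.Dart) // ∀ i, (p.2 i).fst = foot i}

/-- The darts of `G'` are those of `G` together with a set `M` of new ones. The initial vertex of a
new dart belongs to `G` only for the darts `stub i`, which start at the vertices `foot i`. -/
structure DartExtension {V V' : Type} (G : SimpleGraph V) (G' : SimpleGraph V') (I M : Type) where
  equiv : G.Dart ⊕ M ≃ G'.Dart
  inv : Perm M
  emb : V → V'
  foot : I → V
  stub : I → M
  emb_injective : Function.Injective emb
  foot_injective : Function.Injective foot
  exists_dart : ∀ i, ∃ d : G.Dart, d.fst = foot i
  symm_inl : ∀ d : G.Dart, (equiv (Sum.inl d)).symm = equiv (Sum.inl d.symm)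
  symm_inr : ∀ m, (equiv (Sum.inr m)).symm = equiv (Sum.inr (inv m))
  fst_inl : ∀ d : G.Dart, (equiv (Sum.inl d)).fst = emb d.fst
  fst_stub : ∀ i, (equiv (Sum.inr (stub i))).fst = emb (foot i)
  eq_stub : ∀ m v, (equiv (Sum.inr m)).fst = emb v → ∃ i, m = stub i

namespace DartExtension

variable {V V' : Type} {G : SimpleGraph V} {G' : SimpleGraph V'} {I M : Type}
  (D : DartExtension G G' I M)

/-- The initial vertices of the new darts. -/
def vert (m : M) : V' := (D.equiv (Sum.inr m)).fst

theorem fst_equiv : (fun u => (D.equiv u).fst) =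
    Sum.elim (fun d : G.Dart => D.emb d.fst) D.vert := by
  funext u
  rcases u with d | m
  · exact D.fst_inl d
  · rfl

theorem vert_stub_injective : Function.Injective fun i => D.vert (D.stub i) := by
  intro i k h
  simp only [vert, fst_stub] at h
  exact D.foot_injective (D.emb_injective h)

theorem stub_injective : Function.Injective D.stub := fun _ _ h =>
  D.vert_stub_injective (congrArg D.vert h)

theorem vert_eq {m : M} {d : G.Dart} (h : D.vert m = D.emb d.fst) : ∃ i, m = D.stub i :=
  D.eq_stub m _ h

theorem apply_stub {ν : Perm M} (hν : IsRot D.vert ν) (i : I) : ν (D.stub i) = D.stub i := by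
  have h := hν.1 (D.stub i)
  obtain ⟨k, hk⟩ := D.eq_stub (ν (D.stub i)) (D.foot i) (h.trans (D.fst_stub i))
  rw [hk] at h ⊢
  rw [D.vert_stub_injective h]

theorem corner_injective (c : Cornered G D.foot) : Function.Injective c.1.2 := by
  intro i k h
  refine D.foot_injective ?_
  rw [← c.2, ← c.2, h]

theorem isRot_comp (R : RotationSystem G) : IsRot (fun d : G.Dart => D.emb d.fst) R.rot :=
  ⟨fun d => congrArg D.emb (R.fst_rot d), fun _ _ h => R.cyclic _ _ (D.emb_injective h)⟩

theorem isRot_splice (c : Cornered G D.foot) {ν : Perm M} (hν : IsRot D.vert ν) :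
    IsRot (fun u => (D.equiv u).fst) (spliceSwap c.1.2 D.stub (D.corner_injective c)
      D.stub_injective * Equiv.Perm.sumCongr c.1.1.rot ν) := by
  rw [fst_equiv]
  refine IsRot.splice _ _ (fun i => ?_) (fun d m h => D.vert_eq h) (D.isRot_comp c.1.1) hν
    (D.apply_stub hν)
  rw [c.2, vert, fst_stub]

/-- The rotation system of `G'` that arises when the stubs are inserted in the chosen corners. -/
noncomputable def extend (c : Cornered G D.foot) (ν : {ν : Perm M // IsRot D.vert ν}) :
    RotationSystem G' :=
  RotationSystem.ofIsRot D.equiv _ (D.isRot_splice c ν.2)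

theorem extend_bijective [Finite V] [Finite M] : Function.Bijective
    fun p : Cornered G D.foot × {ν : Perm M // IsRot D.vert ν} => D.extend p.1 p.2 := by
  have : Finite G.Dart := Finite.of_injective _ SimpleGraph.Dart.toProd_injective
  constructor
  · rintro ⟨⟨⟨R, x⟩, hx⟩, ν, hν⟩ ⟨⟨⟨R', x'⟩, hx'⟩, ν', hν'⟩ h
    have h := RotationSystem.ofIsRot_injective _ _ _ h
    obtain ⟨h1, h2, h3⟩ := splice_injective _ _ _ (D.apply_stub hν) (D.apply_stub hν') h
    refine Prod.ext (Subtype.ext (Prod.ext ?_ h1)) (Subtype.ext h3)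
    exact RotationSystem.rot_injective h2
  · intro R'
    obtain ⟨τ, hτ, rfl⟩ := RotationSystem.exists_ofIsRot D.equiv R'
    have hτ' := hτ
    rw [fst_equiv] at hτ'
    obtain ⟨x, hx, σ, ν, h1, h2, h3, h4⟩ := hτ'.exists_splice D.stub_injective
      D.vert_stub_injective (fun i => by
        obtain ⟨d, hd⟩ := D.exists_dart i
        exact ⟨d, by rw [hd, vert, fst_stub]⟩) (fun d m h => D.vert_eq h)
    refine ⟨(⟨(⟨σ, fun d => D.emb_injective (h2.1 d), fun d d' h => h2.2 _ _ (congrArg D.emb h)⟩,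
      x), fun i => D.emb_injective (by rw [h1, vert, fst_stub])⟩, ⟨ν, h3⟩), ?_⟩
    refine RotationSystem.rot_injective ?_
    change D.equiv.permCongr _ = D.equiv.permCongr _
    rw [h4]

/-- Face tracing in the extended embedding. -/
theorem isGlue_face (c : Cornered G D.foot) (ν : {ν : Perm M // IsRot D.vert ν}) :
    IsGlue c.1.1.face (D.extend c ν).face D.equiv c.1.2 D.stub fun m => ν.1 (D.inv m) := by
  have hl : ∀ d, (D.extend c ν).face (D.equiv (Sum.inl d)) = D.equiv (spliceSwap c.1.2 D.stub
      (D.corner_injective c) D.stub_injective (Sum.inl (c.1.1.face d))) := fun d => by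
    rw [RotationSystem.face_apply, symm_inl, extend, RotationSystem.ofIsRot_rot]
    rfl
  have hr : ∀ m, (D.extend c ν).face (D.equiv (Sum.inr m)) = D.equiv (spliceSwap c.1.2 D.stub
      (D.corner_injective c) D.stub_injective (Sum.inr (ν.1 (D.inv m)))) := fun d => by
    rw [RotationSystem.face_apply, symm_inr, extend, RotationSystem.ofIsRot_rot]
    rfl
  refine ⟨fun d i h => ?_, fun d h => ?_, fun m i h => ?_, fun m h => ?_⟩
  · rw [hl, h, spliceSwap_inl]
  · rw [hl, spliceSwap_inl_of_ne _ _ h]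
  · rw [hr, h, spliceSwap_inr]
  · rw [hr, spliceSwap_inr_of_ne _ _ h]

include D in
theorem card_dart [Finite V] [Finite M] : Nat.card G'.Dart = Nat.card G.Dart + Nat.card M := by
  have : Finite G.Dart := Finite.of_injective _ SimpleGraph.Dart.toProd_injective
  rw [← Nat.card_congr D.equiv, Nat.card_sum]

end DartExtension

theorem card_dart_eq {V : Type} [Finite V] (G : SimpleGraph V) :
    Nat.card G.Dart = 2 * Nat.card G.edgeSet := by
  classical
  have := Fintype.ofFinite V
  rw [Nat.card_eq_fintype_card, G.dart_card_eq_twice_card_edges, Nat.card_eq_fintype_card,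
    SimpleGraph.edgeFinset_card]

/-! ### One step of a family of fasciagraphs -/

/-- The labels `a, c, d` of the vertices to which the next copy is attached. -/
def foot : Fin 3 → Fin 4 := ![0, 2, 3]

theorem foot_injective : Function.Injective foot := by decide

/-- The permutations of three points. They serve as the states of a cornered embedding: the state is
the first-return map of face tracing to the three chosen corners at `a, c, d`. -/
def statePerm : Fin 6 → Fin 3 → Fin 3 :=
  ![![0, 1, 2], ![0, 2, 1], ![1, 0, 2], ![1, 2, 0], ![2, 0, 1], ![2, 1, 0]]

/-- The cycles of `statePerm s`, in the format of `IsCycleList`. -/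
def stateCycles : Fin 6 → List (Fin 3 × ℕ) :=
  ![[(0, 1), (1, 1), (2, 1)], [(0, 1), (1, 2)], [(0, 2), (2, 1)], [(0, 3)], [(0, 3)],
    [(0, 2), (1, 1)]]

theorem isCycleList_stateCycles (s : Fin 6) : IsCycleList (statePerm s) (stateCycles s) :=
  ⟨by revert s; decide, by revert s; decide, by revert s; decide, by revert s; decide⟩

/-- The increase of the genus when a copy is attached to an embedding in state `s`, with the
rotation number `β` at the new vertex `b`. -/
def genusStep : Fin 6 → Fin 2 → ℕ :=
  ![![2, 2], ![1, 1], ![1, 1], ![0, 1], ![1, 0], ![1, 1]]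

/-- The index `i` such that `chainType i` is the type of the embedding that arises when a copy is
attached to an embedding in state `s`, with the rotation number `β` at the new vertex `b`. -/
def typeIndex : Fin 6 → Fin 2 → Fin 6 :=
  ![![4, 4], ![1, 1], ![3, 3], ![0, 5], ![5, 0], ![2, 2]]

/-- The new state when a copy is attached to an embedding in state `s`, with the rotation number `β`
at the new vertex `b` and with the corners at the new vertices `a, c, d` numbered by `y`. -/
def nextState (s : Fin 6) (β : Fin 2) (y : Fin 3 → Fin 2) : Fin 6 :=
  (![![![![![4, 4], ![3, 3]], ![![4, 4], ![3, 3]]], ![![![4, 4], ![3, 3]], ![![4, 4], ![3, 3]]]],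
    ![![![![1, 5], ![2, 3]], ![![1, 5], ![2, 3]]], ![![![4, 2], ![5, 1]], ![![4, 2], ![5, 1]]]],
    ![![![![1, 1], ![1, 1]], ![![4, 4], ![3, 3]]], ![![![4, 4], ![3, 3]], ![![1, 1], ![1, 1]]]],
    ![![![![1, 0], ![0, 1]], ![![1, 5], ![2, 3]]], ![![![4, 4], ![3, 3]], ![![4, 3], ![4, 3]]]],
    ![![![![4, 3], ![4, 3]], ![![4, 4], ![3, 3]]], ![![![4, 2], ![5, 1]], ![![1, 0], ![0, 1]]]],
    ![![![![4, 2], ![5, 1]], ![![1, 5], ![2, 3]]], ![![![4, 2], ![5, 1]], ![![1, 5], ![2, 3]]]]] :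
    Fin 6 → Fin 2 → Fin 2 → Fin 2 → Fin 2 → Fin 6) s β (y 0) (y 1) (y 2)

/-- Face tracing on the new darts, with stubs `stub i`, reversal `inv` and rotation `ν`, if face
tracing in the old embedding leads from the corner `i` to the corner `ρ i`. -/
def spliceMap {M : Type} [DecidableEq M] (stub : Fin 3 → M) (inv ν : M → M) (ρ : Fin 3 → Fin 3)
    (m : M) : M :=
  if ν (inv m) = stub 0 then stub (ρ 0) else if ν (inv m) = stub 1 then stub (ρ 1)
  else if ν (inv m) = stub 2 then stub (ρ 2) else ν (inv m)

theorem spliceMap_of_eq {M : Type} [DecidableEq M] {stub : Fin 3 → M}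
    (h : Function.Injective stub) {inv ν : M → M} {ρ : Fin 3 → Fin 3} {m : M} {i : Fin 3}
    (hm : ν (inv m) = stub i) : spliceMap stub inv ν ρ m = stub (ρ i) := by
  fin_cases i <;> simp [spliceMap, hm, h.eq_iff]

theorem spliceMap_of_ne {M : Type} [DecidableEq M] {stub : Fin 3 → M}
    {inv ν : M → M} {ρ : Fin 3 → Fin 3} {m : M}
    (hm : ∀ i, ν (inv m) ≠ stub i) : spliceMap stub inv ν ρ m = ν (inv m) := by
  simp [spliceMap, hm]

/-- A finite description of the darts that are added in one step of a family of fasciagraphs,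
together with the (finitely checkable) facts on their face tracing. The initial vertex `src m` of a
new dart is either one of the three old vertices `a, c, d` (for the darts `stub i`) or a new
vertex; `inv` reverses the new darts, `rotation β` are their two rotation systems, `corner k` are
the two darts at the new vertex with the label `foot k`, and `label` gives the labels of the initial
vertices. For each state `s` of the old embedding, `cycles s β` describes the cycles of face tracing
on the new darts. -/
structure PieceModel (C : Constituents (Fin 4)) where
  N : ℕ
  src : Fin N → Fin 3 ⊕ C.W
  inv : Perm (Fin N)
  stub : Fin 3 → Fin N
  rotation : Fin 2 → Perm (Fin N)
  corner : Fin 3 → Fin 2 → Fin N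
  label : Fin N → Option (Fin 4)
  cycles : Fin 6 → Fin 2 → List (Fin N × ℕ)
  finite_V₀ : Finite C.V₀
  finite_W : Finite C.W
  card_darts : N = 2 * (Nat.card C.W + 2)
  inv_inv : ∀ m, inv (inv m) = m
  src_eq_inl : ∀ m i, src m = Sum.inl i ↔ m = stub i
  simple : ∀ m m', src m = src m' → src (inv m) = src (inv m') → m = m'
  inv_stub_ne : ∀ i k, inv (stub i) ≠ stub k
  adj_iff : ∀ w w', C.H.Adj w w' ↔ ∃ m, src m = Sum.inr w ∧ src (inv m) = Sum.inr w'
  B_iff : ∀ i w, C.B i w ↔ ∃ k, foot k = i ∧ src (inv (stub k)) = Sum.inr w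
  isRot_iff : ∀ ν, IsRot src ν ↔ ∃ β, ν = rotation β
  rotation_injective : Function.Injective rotation
  label_eq_some : ∀ m i, label m = some i ↔ src m = Sum.inr (C.s i)
  src_eq_corner : ∀ k m, src m = Sum.inr (C.s (foot k)) ↔ ∃ y, m = corner k y
  corner_injective : ∀ k, Function.Injective (corner k)
  isCycleList : ∀ s β, IsCycleList (spliceMap stub inv (rotation β) (statePerm s)) (cycles s β)
  isReturn : ∀ s β y, IsReturn (spliceMap stub inv (rotation β) (statePerm s))
    (fun k => corner k (y k)) (statePerm (nextState s β y))
  type_eq : ∀ s β,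
    let τ : Multiset (Cycle (Fin 4)) := Multiset.map (fun r : Fin N × ℕ =>
      (((List.iterate (spliceMap stub inv (rotation β) (statePerm s)) r.1 r.2).filterMap label :
        List (Fin 4)) : Cycle (Fin 4))) (cycles s β : Multiset (Fin N × ℕ))
    τ = chainType (typeIndex s β) ∨ τ = (chainType (typeIndex s β)).map Cycle.reverse
  length_eq : ∀ s β, (cycles s β).length + 2 * genusStep s β = 2 + (stateCycles s).length

theorem dart_ext {V : Type} {G : SimpleGraph V} {d d' : G.Dart} (h : d.fst = d'.fst)
    (h' : d.snd = d'.snd) : d = d' :=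
  SimpleGraph.Dart.toProd_injective (Prod.ext h h')

namespace Constituents

variable (C : Constituents (Fin 4))

theorem mark_injective (n : ℕ) : Function.Injective (C.mark n) := by
  cases n with
  | zero => exact C.s₀.injective
  | succ n => exact fun i k h => C.s.injective (Sum.inr_injective h)

end Constituents

namespace PieceModel

variable {C : Constituents (Fin 4)} (P : PieceModel C)

include P in
theorem finite_V (n : ℕ) : Finite (C.V n) := by
  induction n with
  | zero => exact P.finite_V₀
  | succ n ih =>
    have := P.finite_W
    exact inferInstanceAs (Finite (C.V n ⊕ C.W))

theorem stub_injective : Function.Injective P.stub := by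
  intro i k h
  have := (P.src_eq_inl (P.stub i) i).2 rfl
  rw [h, (P.src_eq_inl (P.stub k) k).2 rfl] at this
  exact (Sum.inl_injective this).symm

/-- The initial vertex of a new dart in the next fasciagraph. -/
def vertex (n : ℕ) (m : Fin P.N) : C.V n ⊕ C.W :=
  Sum.map (fun k => C.mark n (foot k)) id (P.src m)

theorem vertex_injective (n : ℕ) : Function.Injective
    (Sum.map (fun k => C.mark n (foot k)) id : Fin 3 ⊕ C.W → C.V n ⊕ C.W) :=
  Sum.map_injective.2 ⟨(C.mark_injective n).comp foot_injective, Function.injective_id⟩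

theorem adj_vertex (n : ℕ) (m : Fin P.N) :
    (C.graph (n + 1)).Adj (P.vertex n m) (P.vertex n (P.inv m)) := by
  rcases h : P.src m with i | w <;> rcases h' : P.src (P.inv m) with k | w'
  · rw [P.src_eq_inl] at h h'
    rw [h] at h'
    exact absurd h' (P.inv_stub_ne _ _)
  · have hm := (P.src_eq_inl _ _).1 h
    rw [hm] at h'
    have hB : C.B (foot i) w' := (P.B_iff _ _).2 ⟨i, rfl, h'⟩
    rw [← hm] at h'
    simp only [vertex, h, h']
    exact ⟨foot i, rfl, hB⟩
  · have hm := (P.src_eq_inl _ _).1 h'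
    have hB : C.B (foot k) w := (P.B_iff _ _).2 ⟨k, rfl, by rw [← hm, P.inv_inv, h]⟩
    simp only [vertex, h, h']
    exact ⟨foot k, rfl, hB⟩
  · simp only [vertex, h, h']
    exact (P.adj_iff _ _).2 ⟨m, h, h'⟩

/-- The darts of the next fasciagraph. -/
def toDart (n : ℕ) : (C.graph n).Dart ⊕ Fin P.N → (C.graph (n + 1)).Dart
  | Sum.inl d => ⟨(Sum.inl d.fst, Sum.inl d.snd), d.adj⟩
  | Sum.inr m => ⟨(P.vertex n m, P.vertex n (P.inv m)), P.adj_vertex n m⟩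

theorem src_of_vertex_eq_inl {n : ℕ} {m : Fin P.N} {v : C.V n} (h : P.vertex n m = Sum.inl v) :
    ∃ i, m = P.stub i := by
  rcases h' : P.src m with i | w
  · exact ⟨i, (P.src_eq_inl _ _).1 h'⟩
  · simp [vertex, h'] at h

theorem toDart_bijective (n : ℕ) : Function.Bijective (P.toDart n) := by
  constructor
  · have key : ∀ d m, P.toDart n (Sum.inl d) ≠ P.toDart n (Sum.inr m) := by
      intro d m h
      have h1 : Sum.inl d.fst = P.vertex n m := congrArg (fun e => e.toProd.1) h
      have h2 : Sum.inl d.snd = P.vertex n (P.inv m) := congrArg (fun e => e.toProd.2) h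
      obtain ⟨i, rfl⟩ := P.src_of_vertex_eq_inl h1.symm
      obtain ⟨k, hk⟩ := P.src_of_vertex_eq_inl h2.symm
      exact P.inv_stub_ne _ _ hk
    rintro (d | m) (d' | m') h
    · have h1 : (Sum.inl d.fst : C.V n ⊕ C.W) = Sum.inl d'.fst := congrArg (fun e => e.toProd.1) h
      have h2 : (Sum.inl d.snd : C.V n ⊕ C.W) = Sum.inl d'.snd := congrArg (fun e => e.toProd.2) h
      exact congrArg _ (dart_ext (Sum.inl_injective h1) (Sum.inl_injective h2))
    · exact absurd h (key _ _)
    · exact absurd h.symm (key _ _)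
    · have h1 : P.vertex n m = P.vertex n m' := congrArg (fun e => e.toProd.1) h
      have h2 : P.vertex n (P.inv m) = P.vertex n (P.inv m') := congrArg (fun e => e.toProd.2) h
      exact congrArg _ (P.simple _ _ (vertex_injective n h1) (vertex_injective n h2))
  · have hB : ∀ {i w}, C.B i w → ∃ k, P.vertex n (P.stub k) = Sum.inl (C.mark n i) ∧
        P.vertex n (P.inv (P.stub k)) = Sum.inr w := by
      intro i w h
      obtain ⟨k, rfl, hk⟩ := (P.B_iff _ _).1 h
      exact ⟨k, by simp [vertex, (P.src_eq_inl _ _).2 rfl], by simp [vertex, hk]⟩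
    rintro ⟨⟨v | w, v' | w'⟩, h⟩
    · exact ⟨Sum.inl ⟨(v, v'), h⟩, rfl⟩
    · obtain ⟨i, rfl, hi⟩ := h
      obtain ⟨k, hk, hk'⟩ := hB hi
      exact ⟨Sum.inr (P.stub k), dart_ext hk hk'⟩
    · obtain ⟨i, rfl, hi⟩ := h
      obtain ⟨k, hk, hk'⟩ := hB hi
      exact ⟨Sum.inr (P.inv (P.stub k)), dart_ext hk' ((congrArg _ (P.inv_inv _)).trans hk)⟩
    · obtain ⟨m, h1, h2⟩ := (P.adj_iff _ _).1 h
      exact ⟨Sum.inr m, dart_ext (by simp only [toDart, vertex, h1]; rfl)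
        (by simp only [toDart, vertex, h2]; rfl)⟩

/-- The vertices of a fasciagraph to which the next copy is attached. -/
def feet (C : Constituents (Fin 4)) (n : ℕ) (k : Fin 3) : C.V n := C.mark n (foot k)

/-- One step of the family, as an extension by finitely many darts. -/
noncomputable def extension (n : ℕ)
    (h : ∀ k, ∃ d : (C.graph n).Dart, d.fst = feet C n k) :
    DartExtension (C.graph n) (C.graph (n + 1)) (Fin 3) (Fin P.N) where
  equiv := Equiv.ofBijective _ (P.toDart_bijective n)
  inv := P.inv
  emb := Sum.inl
  foot := feet C n
  stub := P.stub
  emb_injective := Sum.inl_injective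
  foot_injective := (C.mark_injective n).comp foot_injective
  exists_dart := h
  symm_inl _ := rfl
  symm_inr m := dart_ext rfl (congrArg (P.vertex n) (P.inv_inv m).symm)
  fst_inl _ := rfl
  fst_stub i := by
    change P.vertex n (P.stub i) = _
    simp only [vertex, (P.src_eq_inl _ _).2 rfl]
    rfl
  eq_stub _ _ h := P.src_of_vertex_eq_inl h

variable {n : ℕ} (h : ∀ k, ∃ d : (C.graph n).Dart, d.fst = feet C n k)

theorem isRot_vert_iff (ν : Perm (Fin P.N)) :
    IsRot (P.extension n h).vert ν ↔ ∃ β, ν = P.rotation β := by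
  rw [← P.isRot_iff]
  have hv : ∀ m m', (P.extension n h).vert m = (P.extension n h).vert m' ↔ P.src m = P.src m' :=
    fun m m' => (vertex_injective (C := C) n).eq_iff
  simp only [IsRot, hv]

/-- The two rotations at the new vertices. -/
noncomputable def rotationEquiv :
    Fin 2 ≃ {ν : Perm (Fin P.N) // IsRot (P.extension n h).vert ν} :=
  Equiv.ofBijective (fun β => ⟨P.rotation β, (P.isRot_vert_iff h _).2 ⟨β, rfl⟩⟩)
    ⟨fun β β' e => P.rotation_injective (congrArg Subtype.val e), fun ⟨ν, hν⟩ => by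
      obtain ⟨β, rfl⟩ := (P.isRot_vert_iff h _).1 hν
      exact ⟨β, rfl⟩⟩

/-- An embedding of the next fasciagraph amounts to a cornered embedding of the given one together
with a rotation at the new vertex `b`. -/
noncomputable def extendEquiv :
    Cornered (C.graph n) (feet C n) × Fin 2 ≃ RotationSystem (C.graph (n + 1)) :=
  have := P.finite_V n
  ((Equiv.refl _).prodCongr (P.rotationEquiv h)).trans
    (Equiv.ofBijective _ (P.extension n h).extend_bijective)

theorem fst_corner (k : Fin 3) (y : Fin 2) :
    ((P.extension n h).equiv (Sum.inr (P.corner k y))).fst = feet C (n + 1) k := by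
  have : P.src (P.corner k y) = Sum.inr (C.s (foot k)) := (P.src_eq_corner _ _).2 ⟨y, rfl⟩
  change P.vertex n _ = Sum.inr (C.s (foot k))
  simp [vertex, this]

include P h in
theorem exists_dart_succ : ∀ k, ∃ d : (C.graph (n + 1)).Dart, d.fst = feet C (n + 1) k :=
  fun k => ⟨_, P.fst_corner h k 0⟩

/-- In the next fasciagraph there are two corners at each of the vertices `a, c, d`. -/
noncomputable def cornerEquiv :
    RotationSystem (C.graph (n + 1)) × (Fin 3 → Fin 2) ≃
      Cornered (C.graph (n + 1)) (feet C (n + 1)) :=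
  Equiv.ofBijective
    (fun p => ⟨(p.1, fun k => (P.extension n h).equiv (Sum.inr (P.corner k (p.2 k)))),
      fun k => P.fst_corner h k _⟩) (by
    constructor
    · rintro ⟨R, y⟩ ⟨R', y'⟩ e
      have e := congrArg Subtype.val e
      refine Prod.ext (congrArg (fun p => p.1) e) (funext fun k => ?_)
      have := congrFun (congrArg (fun p => p.2) e) k
      exact P.corner_injective k (Sum.inr_injective ((P.extension n h).equiv.injective this))
    · rintro ⟨⟨R, x⟩, hx⟩
      have : ∀ k, ∃ y, x k = (P.extension n h).equiv (Sum.inr (P.corner k y)) := by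
        intro k
        obtain ⟨u, hu⟩ := (P.extension n h).equiv.surjective (x k)
        have hxk : (x k).fst = feet C (n + 1) k := hx k
        rcases u with d | m
        · rw [← hu] at hxk
          exact absurd hxk Sum.inl_ne_inr
        · rw [← hu] at hxk
          change P.vertex n m = Sum.inr (C.s (foot k)) at hxk
          have : P.src m = Sum.inr (C.s (foot k)) := by
            refine vertex_injective n ?_
            rw [← vertex, hxk]
            rfl
          obtain ⟨y, rfl⟩ := (P.src_eq_corner _ _).1 this
          exact ⟨y, hu.symm⟩
      choose y hy using this
      exact ⟨(R, y), Subtype.ext (Prod.ext rfl (funext fun k => (hy k).symm))⟩)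

end PieceModel

/-! ### Genus and type after one step -/

namespace RotationSystem

variable {V ι : Type} {G : SimpleGraph V} {s : ι → V} {R : RotationSystem G} [DecidableEq ι]

theorem HasOrientedType.unique {τ τ' : Multiset (Cycle ι)} (h : R.HasOrientedType s τ)
    (h' : R.HasOrientedType s τ') (hτ : Cycle.nil ∉ τ) (hτ' : Cycle.nil ∉ τ') : τ = τ' := by
  ext c
  by_cases hc : c = Cycle.nil
  · rw [hc, Multiset.count_eq_zero_of_notMem hτ, Multiset.count_eq_zero_of_notMem hτ']
  · rw [← h c hc, ← h' c hc]

end RotationSystem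

theorem nil_notMem_chainType (i : Fin 6) :
    Cycle.nil ∉ chainType i ∧ Cycle.nil ∉ (chainType i).map Cycle.reverse := by
  revert i
  decide +kernel

/-- The six types are pairwise distinct, even up to inversion. -/
theorem chainType_injective {i k : Fin 6} (h : chainType i = chainType k ∨
    chainType i = (chainType k).map Cycle.reverse ∨
    (chainType i).map Cycle.reverse = chainType k ∨
    (chainType i).map Cycle.reverse = (chainType k).map Cycle.reverse) : i = k := by
  revert i k
  decide +kernel

theorem hasType_chainType_iff {V : Type} {G : SimpleGraph V} {s : Fin 4 → V}
    {R : RotationSystem G} {τ : Multiset (Cycle (Fin 4))} (hR : R.HasOrientedType s τ) {k : Fin 6}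
    (hτ : τ = chainType k ∨ τ = (chainType k).map Cycle.reverse) (i : Fin 6) :
    R.HasType s (chainType i) ↔ i = k := by
  have hnil : Cycle.nil ∉ τ := by
    rcases hτ with rfl | rfl
    exacts [(nil_notMem_chainType k).1, (nil_notMem_chainType k).2]
  constructor
  · rintro (h | h)
    · have e := h.unique hR (nil_notMem_chainType i).1 hnil
      refine chainType_injective ?_
      rcases hτ with rfl | rfl
      exacts [Or.inl e, Or.inr (Or.inl e)]
    · have e := h.unique hR (nil_notMem_chainType i).2 hnil
      refine chainType_injective ?_
      rcases hτ with rfl | rfl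
      exacts [Or.inr (Or.inr (Or.inl e)), Or.inr (Or.inr (Or.inr e))]
  · rintro rfl
    rcases hτ with rfl | rfl
    · exact Or.inl hR
    · refine Or.inr ?_
      exact hR

namespace PieceModel

variable {C : Constituents (Fin 4)} (P : PieceModel C) {n : ℕ}
  (h : ∀ k, ∃ d : (C.graph n).Dart, d.fst = feet C n k)

/-- Face tracing on the darts of the new copy. -/
theorem isReturn_extend (c : Cornered (C.graph n) (feet C n)) (β : Fin 2) {s : Fin 6}
    (hs : IsReturn c.1.1.face c.1.2 (statePerm s)) :
    IsReturn (P.extendEquiv h (c, β)).face (fun m => (P.extension n h).equiv (Sum.inr m))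
      (spliceMap P.stub P.inv (P.rotation β) (statePerm s)) :=
  ((P.extension n h).isGlue_face c (P.rotationEquiv h β)).isReturn hs
    (fun _ _ hm => spliceMap_of_eq P.stub_injective hm) (fun _ hm => spliceMap_of_ne hm)

theorem isReturn_cornerEquiv (c : Cornered (C.graph n) (feet C n)) (β : Fin 2)
    (y : Fin 3 → Fin 2) {s : Fin 6} (hs : IsReturn c.1.1.face c.1.2 (statePerm s)) :
    IsReturn (P.cornerEquiv h (P.extendEquiv h (c, β), y)).1.1.face
      (P.cornerEquiv h (P.extendEquiv h (c, β), y)).1.2 (statePerm (nextState s β y)) :=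
  (P.isReturn_extend h c β hs).trans (P.isReturn s β y)

theorem genus_extend (c : Cornered (C.graph n) (feet C n)) (β : Fin 2) {s : Fin 6}
    (hs : IsReturn c.1.1.face c.1.2 (statePerm s)) :
    (P.extendEquiv h (c, β)).genus = c.1.1.genus + genusStep s β := by
  have hV := P.finite_V n
  have hV' := P.finite_V (n + 1)
  have hW := P.finite_W
  have : Finite (C.graph n).Dart := Finite.of_injective _ SimpleGraph.Dart.toProd_injective
  have : Finite (C.graph (n + 1)).Dart := Finite.of_injective _ SimpleGraph.Dart.toProd_injective
  have hF : Nat.card c.1.1.Faces = (stateCycles s).length + cardAvoiding c.1.1.face c.1.2 :=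
    hs.card_cycles (isCycleList_stateCycles s)
  have hF' : Nat.card (P.extendEquiv h (c, β)).Faces = (P.cycles s β).length +
      cardAvoiding (P.extendEquiv h (c, β)).face
        (fun m => (P.extension n h).equiv (Sum.inr m)) :=
    (P.isReturn_extend h c β hs).card_cycles (P.isCycleList s β)
  have hav := ((P.extension n h).isGlue_face c (P.rotationEquiv h β)).cardAvoiding_eq (fun i =>
    ⟨P.inv (P.stub i), by
      change P.rotation β (P.inv (P.inv (P.stub i))) = P.stub i
      rw [P.inv_inv]
      exact (P.extension n h).apply_stub (P.rotationEquiv h β).2 i⟩)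
  have hav : cardAvoiding (P.extendEquiv h (c, β)).face
      (fun m => (P.extension n h).equiv (Sum.inr m)) = cardAvoiding c.1.1.face c.1.2 := hav
  have hE := (P.extension n h).card_dart
  rw [card_dart_eq, card_dart_eq, Nat.card_fin, P.card_darts, ← mul_add] at hE
  have hE := Nat.eq_of_mul_eq_mul_left two_pos hE
  have hVc : Nat.card (C.V (n + 1)) = Nat.card (C.V n) + Nat.card C.W := Nat.card_sum
  have hl := P.length_eq s β
  rw [hav] at hF'
  simp only [RotationSystem.genus, hE, hVc, hF, hF']
  have hl' : ((P.cycles s β).length : ℚ) = 2 + (stateCycles s).length - 2 * genusStep s β := by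
    have : ((P.cycles s β).length : ℚ) + 2 * genusStep s β = 2 + (stateCycles s).length := by
      exact_mod_cast hl
    linarith
  push_cast
  rw [hl']
  ring

theorem partialInv_mark (m : Fin P.N) :
    Function.partialInv (C.mark (n + 1)) ((P.extension n h).equiv (Sum.inr m)).fst =
      P.label m := by
  ext i
  rw [(C.mark_injective (n + 1)).isPartialInv, P.label_eq_some]
  change Sum.inr (C.s i) = P.vertex n m ↔ _
  have : Sum.inr (C.s i) = Sum.map (fun k => C.mark n (foot k)) id
    (Sum.inr (C.s i) : Fin 3 ⊕ C.W) := rfl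
  rw [this, vertex, (vertex_injective n).eq_iff, eq_comm]

theorem hasType_extend (c : Cornered (C.graph n) (feet C n)) (β : Fin 2) {s : Fin 6}
    (hs : IsReturn c.1.1.face c.1.2 (statePerm s)) (i : Fin 6) :
    (P.extendEquiv h (c, β)).HasType (C.mark (n + 1)) (chainType i) ↔ i = typeIndex s β := by
  have hV' := P.finite_V (n + 1)
  have : Finite (C.graph (n + 1)).Dart := Finite.of_injective _ SimpleGraph.Dart.toProd_injective
  refine hasType_chainType_iff (fun c' hc' => ?_) (P.type_eq s β) i
  have key := (P.isReturn_extend h c β hs).card_cycles_eq_count (P.isCycleList s β)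
    (fun d => Function.partialInv (C.mark (n + 1)) d.fst) (fun d hd => ?_)
    ((P.extendEquiv h (c, β)).faceType (C.mark (n + 1))) (fun _ => rfl) hc'
  · simp only [partialInv_mark] at key
    exact key
  · obtain ⟨u, rfl⟩ := (P.extension n h).equiv.surjective d
    rcases u with d | m
    · refine Option.eq_none_iff_forall_ne_some.2 fun i hi => ?_
      rw [(C.mark_injective (n + 1)).isPartialInv] at hi
      exact Sum.inr_ne_inl hi
    · exact absurd ⟨m, rfl⟩ hd

end PieceModel

/-! ### Generating functions -/

noncomputable section GeneratingFunctions

open Classical in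
instance {V : Type} [Finite V] (G : SimpleGraph V) : Fintype (RotationSystem G) :=
  Fintype.ofFinite _

instance {V I : Type} [Finite V] [Finite I] (G : SimpleGraph V) (x : I → V) :
    Fintype (Cornered G x) :=
  haveI : Finite G.Dart := Finite.of_injective _ SimpleGraph.Dart.toProd_injective
  haveI : Finite (Cornered G x) := Subtype.finite
  Fintype.ofFinite _

open Classical in
theorem stratifiedGenus_eq_sum {V ι : Type} [Finite V] [DecidableEq ι] (G : SimpleGraph V)
    (s : ι → V) (τ : Multiset (Cycle ι)) {gen : RotationSystem G → ℕ}
    (hgen : ∀ R, R.genus = gen R) :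
    stratifiedGenus G s τ = ∑ R, if R.HasType s τ then (X : ℤ[X]) ^ gen R else 0 := by
  have h1 : ∀ g : ℕ, Polynomial.monomial g
      (Nat.card {R : RotationSystem G // R.genus = g ∧ R.HasType s τ} : ℤ) =
      ∑ R, if gen R = g ∧ R.HasType s τ then (X : ℤ[X]) ^ g else 0 := by
    intro g
    rw [Nat.card_eq_fintype_card, Fintype.card_subtype, ← Finset.sum_filter, Finset.sum_const,
      nsmul_eq_mul, ← C_mul_X_pow_eq_monomial]
    simp only [hgen, Nat.cast_inj]
    simp
  rw [stratifiedGenus, finsum_congr h1, finsum_sum_comm]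
  · refine Finset.sum_congr rfl fun R _ => ?_
    rw [finsum_eq_single _ (gen R) fun g hg => if_neg fun h => hg h.1.symm]
    simp
  · intro R _
    refine (Set.finite_singleton (gen R)).subset fun g hg => ?_
    by_contra hne
    exact hg (if_neg fun h => hne h.1.symm)

/-- The states `st` and the genera `gen` of the (cornered) embeddings of a fasciagraph. -/
structure IsStateMap {V : Type} {G : SimpleGraph V} {x : Fin 3 → V} (st : Cornered G x → Fin 6)
    (gen : RotationSystem G → ℕ) : Prop where
  isReturn : ∀ c, IsReturn c.1.1.face c.1.2 (statePerm (st c))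
  genus_eq : ∀ R, R.genus = gen R

/-- The sum of `Y ^ genus * F state` over all cornered embeddings. -/
def stateSum {V : Type} [Finite V] {G : SimpleGraph V} {x : Fin 3 → V} (st : Cornered G x → Fin 6)
    (gen : RotationSystem G → ℕ) (F : Fin 6 → ℤ[X]) : ℤ[X] :=
  ∑ c, X ^ gen c.1.1 * F (st c)

/-- The effect of one step of the family on the functions of the state. -/
def stateTransfer (F : Fin 6 → ℤ[X]) (s : Fin 6) : ℤ[X] :=
  ∑ β, ∑ y, X ^ genusStep s β * F (nextState s β y)

/-- The contribution of a cornered embedding in state `s` to the embeddings of the next fasciagraph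
that have type `chainType i`. -/
def typeWeight (i : Fin 6) (s : Fin 6) : ℤ[X] :=
  ∑ β, if i = typeIndex s β then X ^ genusStep s β else 0

/-- The combined contributions, as in `alphaHat`. -/
def reducedWeight (i : Fin 4) (s : Fin 6) : ℤ[X] :=
  ![typeWeight 0 s, typeWeight 1 s + typeWeight 2 s, typeWeight 3 s,
    typeWeight 4 s + typeWeight 5 s] i

theorem sum_fin_three_fin_two (f : (Fin 3 → Fin 2) → ℤ[X]) :
    ∑ y, f y = f ![0, 0, 0] + f ![0, 0, 1] + f ![0, 1, 0] + f ![0, 1, 1] + f ![1, 0, 0] +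
      f ![1, 0, 1] + f ![1, 1, 0] + f ![1, 1, 1] := by
  have hy : (Finset.univ : Finset (Fin 3 → Fin 2)) = {![0, 0, 0], ![0, 0, 1], ![0, 1, 0],
      ![0, 1, 1], ![1, 0, 0], ![1, 0, 1], ![1, 1, 0], ![1, 1, 1]} := by decide
  rw [hy]
  repeat rw [Finset.sum_insert (by decide)]
  rw [Finset.sum_singleton]
  ring

theorem stateTransfer_eq (F : Fin 6 → ℤ[X]) : stateTransfer F =
    ![8 * X ^ 2 * (F 3 + F 4), 4 * X * (F 1 + F 2 + F 5) + 2 * X * (F 3 + F 4),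
      8 * X * F 1 + 4 * X * (F 3 + F 4),
      2 * F 0 + 3 * F 1 + F 2 + F 3 + F 5 + 4 * X * (F 3 + F 4),
      2 * F 0 + 3 * F 1 + F 2 + F 4 + F 5 + 4 * X * (F 3 + F 4),
      4 * X * (F 1 + F 2 + F 5) + 2 * X * (F 3 + F 4)] := by
  funext s
  simp only [stateTransfer, sum_fin_three_fin_two, Fin.sum_univ_two, ← mul_add]
  fin_cases s <;> simp [genusStep, nextState] <;> ring

theorem reducedWeight_eq : reducedWeight =
    ![![0, 0, 0, 1, 1, 0], ![0, 2 * X, 0, 0, 0, 2 * X], ![0, 0, 2 * X, 0, 0, 0],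
      ![2 * X ^ 2, 0, 0, X, X, 0]] := by
  funext i s
  simp only [reducedWeight, typeWeight, Fin.sum_univ_two]
  fin_cases i <;> fin_cases s <;> simp [typeIndex, genusStep, two_mul]

/-- On the functions `reducedWeight i` the step of the family acts by the reduced transfer
matrix. -/
theorem stateTransfer_reducedWeight (i : Fin 4) :
    stateTransfer (reducedWeight i) =
      fun s => ∑ k, reducedQ (X : ℤ[X]) i k * reducedWeight k s := by
  funext s
  rw [stateTransfer_eq, reducedWeight_eq, Fin.sum_univ_four]
  fin_cases i <;> fin_cases s <;> simp [reducedQ] <;> ring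

theorem stateSum_sum_mul {V : Type} [Finite V] {G : SimpleGraph V} {x : Fin 3 → V}
    (st : Cornered G x → Fin 6) (gen : RotationSystem G → ℕ) (a : Fin 4 → ℤ[X])
    (F : Fin 4 → Fin 6 → ℤ[X]) :
    stateSum st gen (fun s => ∑ k, a k * F k s) = ∑ k, a k * stateSum st gen (F k) := by
  simp only [stateSum, Finset.mul_sum]
  rw [Finset.sum_comm]
  exact Finset.sum_congr rfl fun k _ => Finset.sum_congr rfl fun c _ => by ring

namespace PieceModel

variable {C : Constituents (Fin 4)} (P : PieceModel C) [∀ n, Finite (C.V n)] {n : ℕ}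
  (h : ∀ k, ∃ d : (C.graph n).Dart, d.fst = feet C n k)

include P h in
theorem exists_isStateMap_succ {st : Cornered (C.graph n) (feet C n) → Fin 6}
    {gen : RotationSystem (C.graph n) → ℕ} (hst : IsStateMap st gen) :
    ∃ (st' : Cornered (C.graph (n + 1)) (feet C (n + 1)) → Fin 6)
      (gen' : RotationSystem (C.graph (n + 1)) → ℕ), IsStateMap st' gen' ∧
      ∀ F, stateSum st' gen' F = stateSum st gen (stateTransfer F) := by
  set gen' : RotationSystem (C.graph (n + 1)) → ℕ := fun R =>
    gen ((P.extendEquiv h).symm R).1.1.1 +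
      genusStep (st ((P.extendEquiv h).symm R).1) ((P.extendEquiv h).symm R).2 with hgen'
  set st' : Cornered (C.graph (n + 1)) (feet C (n + 1)) → Fin 6 := fun c =>
    nextState (st ((P.extendEquiv h).symm ((P.cornerEquiv h).symm c).1).1)
      ((P.extendEquiv h).symm ((P.cornerEquiv h).symm c).1).2 ((P.cornerEquiv h).symm c).2 with hst'
  have hg : ∀ c β, gen' (P.extendEquiv h (c, β)) = gen c.1.1 + genusStep (st c) β := by
    intro c β
    simp only [hgen', Equiv.symm_apply_apply]
  have hs : ∀ c β y, st' (P.cornerEquiv h (P.extendEquiv h (c, β), y)) =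
      nextState (st c) β y := by
    intro c β y
    simp only [hst', Equiv.symm_apply_apply]
  refine ⟨st', gen', ⟨fun c' => ?_, fun R => ?_⟩, fun F => ?_⟩
  · obtain ⟨⟨R, y⟩, rfl⟩ := (P.cornerEquiv h).surjective c'
    obtain ⟨⟨c, β⟩, rfl⟩ := (P.extendEquiv h).surjective R
    rw [hs]
    exact P.isReturn_cornerEquiv h c β y (hst.isReturn c)
  · obtain ⟨⟨c, β⟩, rfl⟩ := (P.extendEquiv h).surjective R
    rw [hg, P.genus_extend h c β (hst.isReturn c), hst.genus_eq]
    push_cast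
    rfl
  · rw [stateSum, ← (P.cornerEquiv h).sum_comp, Fintype.sum_prod_type,
      ← (P.extendEquiv h).sum_comp, Fintype.sum_prod_type, stateSum]
    refine Finset.sum_congr rfl fun c _ => ?_
    rw [stateTransfer, Finset.mul_sum]
    refine Finset.sum_congr rfl fun β _ => ?_
    rw [Finset.mul_sum]
    refine Finset.sum_congr rfl fun y _ => ?_
    rw [hs]
    change X ^ gen' (P.extendEquiv h (c, β)) * _ = _
    rw [hg, pow_add, mul_assoc]

include P h in
theorem alpha_succ {st : Cornered (C.graph n) (feet C n) → Fin 6}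
    {gen : RotationSystem (C.graph n) → ℕ} (hst : IsStateMap st gen) (i : Fin 6) :
    alpha C (n + 1) i = stateSum st gen (typeWeight i) := by
  classical
  rw [alpha, stratifiedGenus_eq_sum (gen := fun R => gen ((P.extendEquiv h).symm R).1.1.1 +
      genusStep (st ((P.extendEquiv h).symm R).1) ((P.extendEquiv h).symm R).2),
    ← (P.extendEquiv h).sum_comp, Fintype.sum_prod_type, stateSum]
  · refine Finset.sum_congr rfl fun c _ => ?_
    rw [typeWeight, Finset.mul_sum]
    refine Finset.sum_congr rfl fun β _ => ?_
    rw [Equiv.symm_apply_apply, mul_ite, mul_zero, pow_add]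
    exact if_congr (P.hasType_extend h c β (hst.isReturn c) i) rfl rfl
  · intro R
    obtain ⟨⟨c, β⟩, rfl⟩ := (P.extendEquiv h).surjective R
    rw [P.genus_extend h c β (hst.isReturn c), hst.genus_eq, Equiv.symm_apply_apply]
    push_cast
    rfl

include P h in
theorem alphaHat_succ {st : Cornered (C.graph n) (feet C n) → Fin 6}
    {gen : RotationSystem (C.graph n) → ℕ} (hst : IsStateMap st gen) (i : Fin 4) :
    alphaHat C (n + 1) i = stateSum st gen (reducedWeight i) := by
  have hadd : ∀ F F' : Fin 6 → ℤ[X], stateSum st gen (fun s => F s + F' s) =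
      stateSum st gen F + stateSum st gen F' := fun F F' => by
    simp only [stateSum, mul_add, Finset.sum_add_distrib]
  simp only [alphaHat, P.alpha_succ h hst]
  fin_cases i
  · rfl
  · exact (hadd _ _).symm
  · rfl
  · exact (hadd _ _).symm

include P in
/-- If the path `P₄` at the start contributes the two cornered embeddings of genus `0` whose states
are the two cyclic permutations, the family is governed by the reduced transfer matrix. -/
theorem alphaHat_eq (h : ∀ k, ∃ d : (C.graph 0).Dart, d.fst = feet C 0 k)
    (h₀ : ∃ (st : Cornered (C.graph 0) (feet C 0) → Fin 6)
      (gen : RotationSystem (C.graph 0) → ℕ), IsStateMap st gen ∧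
      ∀ F, stateSum st gen F = F 3 + F 4) {n : ℕ} (hn : 1 ≤ n) :
    alphaHat C n = (reducedQ (X : ℤ[X]) ^ (n - 1)).mulVec ![2, 0, 0, 2 * X] := by
  have hdart : ∀ n, ∀ k, ∃ d : (C.graph n).Dart, d.fst = feet C n k := by
    intro n
    induction n with
    | zero => exact h
    | succ n ih => exact P.exists_dart_succ ih
  have key : ∀ n, ∃ (st : Cornered (C.graph n) (feet C n) → Fin 6)
      (gen : RotationSystem (C.graph n) → ℕ), IsStateMap st gen ∧
      ∀ i, stateSum st gen (reducedWeight i) =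
        (reducedQ (X : ℤ[X]) ^ n).mulVec ![2, 0, 0, 2 * X] i := by
    intro n
    induction n with
    | zero =>
      obtain ⟨st, gen, hst, hF⟩ := h₀
      refine ⟨st, gen, hst, fun i => ?_⟩
      rw [hF, pow_zero, Matrix.one_mulVec]
      rw [reducedWeight_eq]
      fin_cases i <;> simp <;> ring
    | succ n ih =>
      obtain ⟨st, gen, hst, hF⟩ := ih
      obtain ⟨st', gen', hst', hF'⟩ := P.exists_isStateMap_succ (hdart n) hst
      refine ⟨st', gen', hst', fun i => ?_⟩
      rw [hF', stateTransfer_reducedWeight, stateSum_sum_mul, pow_succ', ← Matrix.mulVec_mulVec]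
      simp only [hF]
      rfl
  obtain ⟨n, rfl⟩ : ∃ m, n = m + 1 := ⟨n - 1, by omega⟩
  obtain ⟨st, gen, hst, hF⟩ := key n
  funext i
  rw [P.alphaHat_succ (hdart n) hst, hF, Nat.add_sub_cancel]

end PieceModel

end GeneratingFunctions

/-! ### The new darts in the two families -/

/-- A permutation of `n` points given by the list of its values and the list of the values of its
inverse. -/
def permOfVec {n : ℕ} (f g : Fin n → Fin n) (h : ∀ i, g (f i) = i ∧ f (g i) = i) : Perm (Fin n) :=
  ⟨f, g, fun i => (h i).1, fun i => (h i).2⟩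

/-- The index of the first of the points `y 0, y 1, y 2` that is met within `n` steps. -/
def firstHit {M : Type} [DecidableEq M] (f : M → M) (y : Fin 3 → M) : ℕ → M → Option (Fin 3)
  | 0, _ => none
  | n + 1, m => if m = y 0 then some 0 else if m = y 1 then some 1 else if m = y 2 then some 2
    else firstHit f y n (f m)

/-- A check by computation that `π` is the first-return map of `f` to the points `y i`. -/
abbrev CheckReturn {M : Type} [DecidableEq M] (n : ℕ) (f : M → M) (y : Fin 3 → M)
    (π : Fin 3 → Fin 3) : Prop :=
  (∀ i, firstHit f y n (y i) = some i) ∧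
    (∀ a, (∀ i, y i ≠ a) → firstHit f y n (f a) = firstHit f y n a) ∧
    ∀ i, firstHit f y n (f (y i)) = some (π i)

theorem CheckReturn.isReturn {M : Type} [DecidableEq M] {n : ℕ} {f : M → M} {y : Fin 3 → M}
    {π : Fin 3 → Fin 3} (h : CheckReturn n f y π) : IsReturn f y π :=
  ⟨firstHit f y n, h.1, fun a ha => h.2.1 a fun i hi => ha ⟨i, hi⟩, h.2.2⟩

theorem isReturn_of_checkReturn {M : Type} [DecidableEq M] {n : ℕ} {f : Fin 6 → Fin 2 → M → M}
    {corner : Fin 3 → Fin 2 → M}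
    (h : ∀ s β a b c, CheckReturn n (f s β) (fun k => corner k (![a, b, c] k))
      (statePerm (nextState s β ![a, b, c]))) (s : Fin 6) (β : Fin 2) (y : Fin 3 → Fin 2) :
    IsReturn (f s β) (fun k => corner k (y k)) (statePerm (nextState s β y)) := by
  have hy : ![y 0, y 1, y 2] = y := by
    funext i
    fin_cases i <;> rfl
  have := h s β (y 0) (y 1) (y 2)
  rw [hy] at this
  exact this.isReturn

theorem IsRot.apply_ne {A V : Type} {v : A → V} {σ : Perm A} (h : IsRot v σ) {a b : A}
    (hab : v b = v a) (hne : b ≠ a) : σ a ≠ a := by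
  intro ha
  obtain ⟨n, hn⟩ := h.2 a b hab.symm
  rw [Equiv.Perm.zpow_apply_eq_self_of_apply_eq_self ha] at hn
  exact hne hn.symm

/-- If all vertices have degree at most two, except for one vertex of degree three with the darts
`b 0, b 1, b 2`, then there are exactly two rotation systems. -/
theorem isRot_iff_of_degree_le {A V : Type} {v : A → V} {rot : Fin 2 → Perm A} {b : Fin 3 → A}
    (hv : ∀ β a, v (rot β a) = v a)
    (hcyc : ∀ β a a', v a = v a' → ∃ i : Fin 3, (rot β)^[i] a = a')
    (hb : ∀ a, v a = v (b 0) ↔ a = b 0 ∨ a = b 1 ∨ a = b 2)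
    (hrot : rot 0 (b 0) = b 1 ∧ rot 0 (b 1) = b 2 ∧ rot 0 (b 2) = b 0 ∧
      rot 1 (b 0) = b 2 ∧ rot 1 (b 2) = b 1 ∧ rot 1 (b 1) = b 0)
    (hbinj : b 0 ≠ b 1 ∧ b 0 ≠ b 2 ∧ b 1 ≠ b 2)
    (hdeg : ∀ a k, v a ≠ v (b 0) → v k = v a → (k = a → ∀ a', v a' = v a → a' = a) →
      ∀ β, k = rot β a) (ν : Perm A) :
    IsRot v ν ↔ ∃ β, ν = rot β := by
  constructor
  · intro h
    obtain ⟨r1, r2, r3, r4, r5, r6⟩ := hrot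
    obtain ⟨n1, n2, n3⟩ := hbinj
    have hother : ∀ β a, v a ≠ v (b 0) → ν a = rot β a := fun β a ha =>
      hdeg a (ν a) ha (h.1 a) (fun hk a' ha' => by
        by_contra hne
        exact h.apply_ne ha' hne hk) β
    have v1 : v (b 1) = v (b 0) := (hb _).2 (Or.inr (Or.inl rfl))
    have v2 : v (b 2) = v (b 0) := (hb _).2 (Or.inr (Or.inr rfl))
    have m0 := (hb _).1 (h.1 (b 0))
    have m1 := (hb _).1 ((h.1 (b 1)).trans v1)
    have m2 := (hb _).1 ((h.1 (b 2)).trans v2)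
    have f0 := h.apply_ne v1 n1.symm
    have f1 := h.apply_ne v1.symm n1
    have f2 := h.apply_ne v2.symm n2
    have i01 : ν (b 0) ≠ ν (b 1) := fun e => n1 (ν.injective e)
    have i02 : ν (b 0) ≠ ν (b 2) := fun e => n2 (ν.injective e)
    have i12 : ν (b 1) ≠ ν (b 2) := fun e => n3 (ν.injective e)
    have hall : (ν (b 0) = b 1 ∧ ν (b 1) = b 2 ∧ ν (b 2) = b 0) ∨
        (ν (b 0) = b 2 ∧ ν (b 2) = b 1 ∧ ν (b 1) = b 0) := by
      grind
    have hext : ∀ β, ν (b 0) = rot β (b 0) → ν (b 1) = rot β (b 1) → ν (b 2) = rot β (b 2) →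
        ν = rot β := by
      intro β e0 e1 e2
      ext1 a
      by_cases ha : v a = v (b 0)
      · rcases (hb a).1 ha with rfl | rfl | rfl
        exacts [e0, e1, e2]
      · exact hother β a ha
    rcases hall with ⟨e0, e1, e2⟩ | ⟨e0, e2, e1⟩
    · exact ⟨0, hext 0 (e0.trans r1.symm) (e1.trans r2.symm) (e2.trans r3.symm)⟩
    · exact ⟨1, hext 1 (e0.trans r4.symm) (e1.trans r6.symm) (e2.trans r5.symm)⟩
  · rintro ⟨β, rfl⟩
    refine ⟨hv β, fun a a' haa' => ?_⟩
    obtain ⟨i, hi⟩ := hcyc β a a' haa'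
    exact ⟨(i : ℕ), by rw [zpow_natCast, ← Equiv.Perm.iterate_eq_pow, hi]⟩

namespace PathPiece

/-- The initial vertices of the new darts: the stubs `0, 1, 2` start at the old `a, c, d`, the darts
`3, 4` at the new `a`, the darts `5, 6, 7` at the new `b`, the darts `8, 9` at the new `c`, the
darts `10, 11` at the new `d`. -/
def src : Fin 12 → Fin 3 ⊕ Fin 4 :=
  ![.inl 0, .inl 1, .inl 2, .inr 0, .inr 0, .inr 1, .inr 1, .inr 1, .inr 2, .inr 2, .inr 3, .inr 3]

/-- The reversal of the new darts. -/
def inv : Perm (Fin 12) :=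
  permOfVec ![3, 7, 11, 0, 5, 4, 8, 1, 6, 10, 9, 2] ![3, 7, 11, 0, 5, 4, 8, 1, 6, 10, 9, 2]
    (by decide)

/-- The two rotation systems of the new darts; they differ at the new vertex `b`. -/
def rotation : Fin 2 → Perm (Fin 12) :=
  ![permOfVec ![0, 1, 2, 4, 3, 6, 7, 5, 9, 8, 11, 10] ![0, 1, 2, 4, 3, 7, 5, 6, 9, 8, 11, 10]
      (by decide),
    permOfVec ![0, 1, 2, 4, 3, 7, 5, 6, 9, 8, 11, 10] ![0, 1, 2, 4, 3, 6, 7, 5, 9, 8, 11, 10]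
      (by decide)]

/-- The labels of the initial vertices of the new darts. -/
def label : Fin 12 → Option (Fin 4) :=
  ![none, none, none, some 0, some 0, some 1, some 1, some 1, some 2, some 2, some 3, some 3]

/-- The cycles of face tracing on the new darts, for each state and each rotation at `b`. -/
def cycles : Fin 6 → Fin 2 → List (Fin 12 × ℕ) :=
  ![![[(0, 12)], [(0, 12)]], ![[(0, 8), (2, 4)], [(0, 8), (1, 4)]],
    ![[(0, 9), (1, 3)], [(0, 3), (1, 9)]], ![[(0, 5), (1, 3), (2, 4)], [(0, 12)]],
    ![[(0, 12)], [(0, 3), (1, 4), (2, 5)]], ![[(0, 5), (1, 7)], [(0, 7), (2, 5)]]]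

theorem adj_iff : ∀ w w' : Fin 4, (SimpleGraph.pathGraph 4).Adj w w' ↔
    ∃ m, src m = Sum.inr w ∧ src (inv m) = Sum.inr w' := by
  simp only [SimpleGraph.pathGraph_adj]
  decide +kernel

theorem B_iff : ∀ (i w : Fin 4), ((i = 0 ∧ w = 0) ∨ (i = 2 ∧ w = 1) ∨ (i = 3 ∧ w = 3)) ↔
    ∃ k, foot k = i ∧ src (inv (![0, 1, 2] k)) = Sum.inr w := by
  decide +kernel

theorem isCycleList (s : Fin 6) (β : Fin 2) :
    IsCycleList (spliceMap ![0, 1, 2] inv (rotation β) (statePerm s)) (cycles s β) := by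
  refine ⟨?_, ?_, ?_, ?_⟩ <;> revert s β <;> decide +kernel

theorem type_eq (s : Fin 6) (β : Fin 2) :
    let τ : Multiset (Cycle (Fin 4)) := Multiset.map (fun r : Fin 12 × ℕ =>
      (((List.iterate (spliceMap ![0, 1, 2] inv (rotation β) (statePerm s)) r.1 r.2).filterMap
        label : List (Fin 4)) : Cycle (Fin 4))) (cycles s β : Multiset (Fin 12 × ℕ))
    τ = chainType (typeIndex s β) ∨ τ = (chainType (typeIndex s β)).map Cycle.reverse := by
  revert s β
  decide +kernel

/-- The new darts in the family with `D₀ = H = P₄`. -/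
def model : PieceModel pathConstituents where
  N := 12
  src := src
  inv := inv
  stub := ![0, 1, 2]
  rotation := rotation
  corner := ![![3, 4], ![8, 9], ![10, 11]]
  label := label
  cycles := cycles
  finite_V₀ := inferInstanceAs (Finite (Fin 4))
  finite_W := inferInstanceAs (Finite (Fin 4))
  card_darts := by
    have : Nat.card pathConstituents.W = 4 := Nat.card_fin 4
    rw [this]
  inv_inv := by decide +kernel
  src_eq_inl := show ∀ m i, src m = Sum.inl i ↔ m = ![0, 1, 2] i by decide +kernel
  simple := show ∀ m m', src m = src m' → src (inv m) = src (inv m') → m = m' by decide +kernel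
  inv_stub_ne := by decide +kernel
  adj_iff := adj_iff
  B_iff := B_iff
  isRot_iff := isRot_iff_of_degree_le (v := src) (b := ![5, 6, 7]) (by decide +kernel)
    (by decide +kernel) (by decide +kernel) (by decide +kernel) (by decide +kernel)
    (by decide +kernel)
  rotation_injective := by decide +kernel
  label_eq_some := show ∀ m i, label m = some i ↔ src m = Sum.inr i by decide +kernel
  src_eq_corner := show ∀ k m, src m = Sum.inr (foot k) ↔
    ∃ y, m = (![![3, 4], ![8, 9], ![10, 11]] : Fin 3 → Fin 2 → Fin 12) k y by decide +kernel
  corner_injective := by decide +kernel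
  isCycleList := isCycleList
  isReturn := isReturn_of_checkReturn (n := 12) (by decide +kernel)
  type_eq := type_eq
  length_eq := by decide +kernel

end PathPiece

namespace HexagonalPiece

/-- The initial vertices of the new darts. The darts `0, …, 11` are numbered as in `PathPiece.src`,
the darts `12, 13` start at `t` and the darts `14, 15` at `u`. -/
def src : Fin 16 → Fin 3 ⊕ (Fin 4 ⊕ Fin 2) :=
  ![.inl 0, .inl 1, .inl 2, .inr (.inl 0), .inr (.inl 0), .inr (.inl 1), .inr (.inl 1),
    .inr (.inl 1), .inr (.inl 2), .inr (.inl 2), .inr (.inl 3), .inr (.inl 3), .inr (.inr 0),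
    .inr (.inr 0), .inr (.inr 1), .inr (.inr 1)]

/-- The reversal of the new darts. -/
def inv : Perm (Fin 16) :=
  permOfVec ![13, 7, 15, 12, 5, 4, 8, 1, 6, 10, 9, 14, 3, 0, 11, 2]
    ![13, 7, 15, 12, 5, 4, 8, 1, 6, 10, 9, 14, 3, 0, 11, 2] (by decide)

/-- The two rotation systems of the new darts; they differ at the new vertex `b`. -/
def rotation : Fin 2 → Perm (Fin 16) :=
  ![permOfVec ![0, 1, 2, 4, 3, 6, 7, 5, 9, 8, 11, 10, 13, 12, 15, 14]
      ![0, 1, 2, 4, 3, 7, 5, 6, 9, 8, 11, 10, 13, 12, 15, 14] (by decide),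
    permOfVec ![0, 1, 2, 4, 3, 7, 5, 6, 9, 8, 11, 10, 13, 12, 15, 14]
      ![0, 1, 2, 4, 3, 6, 7, 5, 9, 8, 11, 10, 13, 12, 15, 14] (by decide)]

/-- The labels of the initial vertices of the new darts. -/
def label : Fin 16 → Option (Fin 4) :=
  ![none, none, none, some 0, some 0, some 1, some 1, some 1, some 2, some 2, some 3, some 3,
    none, none, none, none]

/-- The cycles of face tracing on the new darts, for each state and each rotation at `b`. -/
def cycles : Fin 6 → Fin 2 → List (Fin 16 × ℕ) :=
  ![![[(0, 16)], [(0, 16)]], ![[(0, 11), (2, 5)], [(0, 11), (1, 5)]],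
    ![[(0, 12), (1, 4)], [(0, 4), (1, 12)]], ![[(0, 7), (1, 4), (2, 5)], [(0, 16)]],
    ![[(0, 16)], [(0, 4), (1, 5), (2, 7)]], ![[(0, 7), (1, 9)], [(0, 9), (2, 7)]]]

theorem adj_iff : ∀ w w' : Fin 4 ⊕ Fin 2, hexagonalConstituents.H.Adj w w' ↔
    ∃ m, src m = Sum.inr w ∧ src (inv m) = Sum.inr w' := by
  have h : ∀ w w' : Fin 4 ⊕ Fin 2, hexagonalConstituents.H.Adj w w' ↔
      (∃ i k : Fin 4, w = .inl i ∧ w' = .inl k ∧ (i.val + 1 = k.val ∨ k.val + 1 = i.val)) ∨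
      (w ≠ w' ∧ (((w = .inl 0 ∧ w' = .inr 0) ∨ (w = .inl 3 ∧ w' = .inr 1)) ∨
        ((w' = .inl 0 ∧ w = .inr 0) ∨ (w' = .inl 3 ∧ w = .inr 1)))) := by
    rintro (i | i) (k | k) <;>
      simp [hexagonalConstituents, SimpleGraph.pathGraph_adj]
  simp only [h]
  decide +kernel

theorem B_iff : ∀ (i : Fin 4) (w : Fin 4 ⊕ Fin 2),
    ((i = 0 ∧ w = Sum.inr 0) ∨ (i = 2 ∧ w = Sum.inl 1) ∨ (i = 3 ∧ w = Sum.inr 1)) ↔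
    ∃ k, foot k = i ∧ src (inv (![0, 1, 2] k)) = Sum.inr w := by
  decide +kernel

theorem isCycleList (s : Fin 6) (β : Fin 2) :
    IsCycleList (spliceMap ![0, 1, 2] inv (rotation β) (statePerm s)) (cycles s β) := by
  refine ⟨?_, ?_, ?_, ?_⟩ <;> revert s β <;> decide +kernel

theorem type_eq (s : Fin 6) (β : Fin 2) :
    let τ : Multiset (Cycle (Fin 4)) := Multiset.map (fun r : Fin 16 × ℕ =>
      (((List.iterate (spliceMap ![0, 1, 2] inv (rotation β) (statePerm s)) r.1 r.2).filterMap
        label : List (Fin 4)) : Cycle (Fin 4))) (cycles s β : Multiset (Fin 16 × ℕ))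
    τ = chainType (typeIndex s β) ∨ τ = (chainType (typeIndex s β)).map Cycle.reverse := by
  revert s β
  decide +kernel

/-- The new darts in the doubly hexagonal chain. -/
def model : PieceModel hexagonalConstituents where
  N := 16
  src := src
  inv := inv
  stub := ![0, 1, 2]
  rotation := rotation
  corner := ![![3, 4], ![8, 9], ![10, 11]]
  label := label
  cycles := cycles
  finite_V₀ := inferInstanceAs (Finite (Fin 4))
  finite_W := inferInstanceAs (Finite (Fin 4 ⊕ Fin 2))
  card_darts := by
    have : Nat.card hexagonalConstituents.W = 6 := by
      change Nat.card (Fin 4 ⊕ Fin 2) = 6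
      simp
    rw [this]
  inv_inv := by decide +kernel
  src_eq_inl := show ∀ m i, src m = Sum.inl i ↔ m = ![0, 1, 2] i by decide +kernel
  simple := show ∀ m m', src m = src m' → src (inv m) = src (inv m') → m = m' by decide +kernel
  inv_stub_ne := by decide +kernel
  adj_iff := adj_iff
  B_iff := B_iff
  isRot_iff := isRot_iff_of_degree_le (v := src) (b := ![5, 6, 7]) (by decide +kernel)
    (by decide +kernel) (by decide +kernel) (by decide +kernel) (by decide +kernel)
    (by decide +kernel)
  rotation_injective := by decide +kernel
  label_eq_some := show ∀ m i, label m = some i ↔ src m = Sum.inr (Sum.inl i) by decide +kernel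
  src_eq_corner := show ∀ k m, src m = Sum.inr (Sum.inl (foot k)) ↔
    ∃ y, m = (![![3, 4], ![8, 9], ![10, 11]] : Fin 3 → Fin 2 → Fin 16) k y by decide +kernel
  corner_injective := by decide +kernel
  isCycleList := isCycleList
  isReturn := isReturn_of_checkReturn (n := 16) (by decide +kernel)
  type_eq := type_eq
  length_eq := by decide +kernel

end HexagonalPiece

/-! ### The path at the start of the families -/

namespace PathStart

/-- The initial vertices of the six darts of the path `a b c d`. -/
def src : Fin 6 → Fin 4 := ![0, 1, 1, 2, 2, 3]

/-- The reversal of the darts. -/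
def inv : Perm (Fin 6) := permOfVec ![1, 0, 3, 2, 5, 4] ![1, 0, 3, 2, 5, 4] (by decide)

/-- The only rotation system of the path. -/
def rotation : Perm (Fin 6) := permOfVec ![0, 2, 1, 4, 3, 5] ![0, 2, 1, 4, 3, 5] (by decide)

/-- The choices of corners at `a, c, d`; there is only one corner at `a` and at `d`. -/
def corner (y : Fin 2) : Fin 3 → Fin 6 := ![0, ![3, 4] y, 5]

theorem adj_iff : ∀ v v' : Fin 4, (SimpleGraph.pathGraph 4).Adj v v' ↔
    ∃ m, src m = v ∧ src (inv m) = v' := by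
  simp only [SimpleGraph.pathGraph_adj]
  decide +kernel

/-- The darts of the path. -/
noncomputable def dartEquiv : Fin 6 ≃ (SimpleGraph.pathGraph 4).Dart :=
  Equiv.ofBijective
    (fun m => ⟨(src m, src (inv m)), (adj_iff _ _).2 ⟨m, rfl, rfl⟩⟩) (by
    constructor
    · intro m m' h
      have h1 : src m = src m' := congrArg (fun e => e.toProd.1) h
      have h2 : src (inv m) = src (inv m') := congrArg (fun e => e.toProd.2) h
      revert m m'
      decide +kernel
    · rintro ⟨⟨v, v'⟩, h⟩
      obtain ⟨m, h1, h2⟩ := (adj_iff _ _).1 h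
      exact ⟨m, dart_ext h1 h2⟩)

theorem isRot_iff (ν : Perm (Fin 6)) : IsRot (fun m => (dartEquiv m).fst) ν ↔ ν = rotation := by
  change IsRot src ν ↔ _
  constructor
  · intro h
    have hdeg : ∀ a k, src k = src a → (k = a → ∀ a', src a' = src a → a' = a) →
        k = rotation a := by decide +kernel
    ext1 a
    refine hdeg a (ν a) (h.1 a) fun hk a' ha' => ?_
    by_contra hne
    exact h.apply_ne ha' hne hk
  · rintro rfl
    have hcyc : ∀ a a', src a = src a' → ∃ i : Fin 2, rotation^[i] a = a' := by decide +kernel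
    refine ⟨by decide +kernel, fun a a' h => ?_⟩
    obtain ⟨i, hi⟩ := hcyc a a' h
    exact ⟨(i : ℕ), by rw [zpow_natCast, ← Equiv.Perm.iterate_eq_pow, hi]⟩

/-- The only embedding of the path. -/
noncomputable def embedding : RotationSystem (SimpleGraph.pathGraph 4) :=
  .ofIsRot dartEquiv rotation ((isRot_iff _).2 rfl)

theorem eq_embedding (R : RotationSystem (SimpleGraph.pathGraph 4)) : R = embedding := by
  obtain ⟨σ, h, rfl⟩ := R.exists_ofIsRot dartEquiv
  obtain rfl := (isRot_iff _).1 h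
  rfl

theorem isReturn_face : IsReturn embedding.face dartEquiv fun m => rotation (inv m) := by
  have hsymm : ∀ m, (dartEquiv m).symm = dartEquiv (inv m) := fun m => by
    have : ∀ m, inv (inv m) = m := by decide +kernel
    exact dart_ext rfl (congrArg src (this m).symm)
  have hface : ∀ m, embedding.face (dartEquiv m) = dartEquiv (rotation (inv m)) := fun m => by
    rw [RotationSystem.face_apply, hsymm]
    exact RotationSystem.ofIsRot_rot _ _ _
  exact ⟨fun d => some (dartEquiv.symm d), fun m => by simp,
    fun a ha => absurd (dartEquiv.surjective a) ha, fun m => by simp [hface]⟩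

theorem genus_embedding : embedding.genus = 0 := by
  have : Finite (SimpleGraph.pathGraph 4).Dart :=
    Finite.of_injective _ SimpleGraph.Dart.toProd_injective
  have hF : Nat.card embedding.Faces = 1 := by
    have h := isReturn_face.card_cycles (reps := [(0, 6)])
      ⟨by decide +kernel, by decide +kernel, by decide +kernel, by decide +kernel⟩
    refine h.trans ?_
    have : IsEmpty {q : Quotient (Equiv.Perm.SameCycle.setoid embedding.face) //
        ∀ m, q ≠ Quotient.mk _ (dartEquiv m)} := by
      refine ⟨fun ⟨q, hq⟩ => ?_⟩
      obtain ⟨d, rfl⟩ := Quotient.exists_rep q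
      obtain ⟨m, rfl⟩ := dartEquiv.surjective d
      exact hq m rfl
    rw [cardAvoiding, Nat.card_of_isEmpty]
    rfl
  have hE : Nat.card (SimpleGraph.pathGraph 4).edgeSet = 3 := by
    have h := card_dart_eq (SimpleGraph.pathGraph 4)
    rw [← Nat.card_congr dartEquiv, Nat.card_fin] at h
    omega
  rw [RotationSystem.genus, hF, hE, Nat.card_fin]
  norm_num

/-- The two cornered embeddings of the path. -/
noncomputable def corneredEquiv : Fin 2 ≃ Cornered (SimpleGraph.pathGraph 4) foot :=
  Equiv.ofBijective (fun y => ⟨(embedding, fun k => dartEquiv (corner y k)), by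
    change ∀ k, src (corner y k) = foot k
    revert y
    decide⟩) (by
    constructor
    · intro y y' h
      have hc : ∀ y y', corner y 1 = corner y' 1 → y = y' := by decide
      exact hc _ _ (dartEquiv.injective (congrFun (congrArg (fun c => c.1.2) h) 1))
    · rintro ⟨⟨R, x⟩, hx⟩
      obtain rfl := eq_embedding R
      have hex : ∀ m0 m1 m2, src m0 = foot 0 → src m1 = foot 1 → src m2 = foot 2 →
          ∃ y, m0 = corner y 0 ∧ m1 = corner y 1 ∧ m2 = corner y 2 := by decide +kernel
      have hs : ∀ k, src (dartEquiv.symm (x k)) = foot k := fun k => by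
        have h : (dartEquiv (dartEquiv.symm (x k))).fst = src (dartEquiv.symm (x k)) := rfl
        rw [← h, Equiv.apply_symm_apply]
        exact hx k
      obtain ⟨y, h0, h1, h2⟩ := hex _ _ _ (hs 0) (hs 1) (hs 2)
      refine ⟨y, Subtype.ext (Prod.ext rfl (funext fun k => ?_))⟩
      change dartEquiv (corner y k) = x k
      rw [← Equiv.eq_symm_apply]
      fin_cases k
      exacts [h0.symm, h1.symm, h2.symm])

theorem exists_dart (k : Fin 3) : ∃ d : (SimpleGraph.pathGraph 4).Dart, d.fst = foot k :=
  ⟨_, (corneredEquiv 0).2 k⟩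

theorem exists_isStateMap : ∃ (st : Cornered (SimpleGraph.pathGraph 4) foot → Fin 6)
    (gen : RotationSystem (SimpleGraph.pathGraph 4) → ℕ), IsStateMap st gen ∧
    ∀ F, stateSum st gen F = F 3 + F 4 := by
  refine ⟨fun c => ![4, 3] (corneredEquiv.symm c), fun _ => 0, ⟨fun c => ?_, fun R => ?_⟩,
    fun F => ?_⟩
  · obtain ⟨y, rfl⟩ := corneredEquiv.surjective c
    rw [Equiv.symm_apply_apply]
    have : ∀ y : Fin 2, CheckReturn 6 (fun m => rotation (inv m)) (corner y)
        (statePerm (![4, 3] y)) := by decide +kernel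
    exact isReturn_face.trans (this y).isReturn
  · rw [eq_embedding R, genus_embedding]
    rfl
  · rw [stateSum, ← corneredEquiv.sum_comp]
    simp [Fin.sum_univ_two, add_comm]

end PathStart

theorem alphaHat_eq_mulVec {D : Constituents (Fin 4)}
    (hD : D = hexagonalConstituents ∨ D = pathConstituents) {n : ℕ} (hn : 1 ≤ n) :
    alphaHat D n = (reducedQ (X : ℤ[X]) ^ (n - 1)).mulVec ![2, 0, 0, 2 * X] := by
  rcases hD with rfl | rfl
  · have := HexagonalPiece.model.finite_V
    exact HexagonalPiece.model.alphaHat_eq PathStart.exists_dart PathStart.exists_isStateMap hn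
  · have := PathPiece.model.finite_V
    exact PathPiece.model.alphaHat_eq PathStart.exists_dart PathStart.exists_isStateMap hn

/-! ### The characteristic polynomial and its roots in radicals -/

theorem reducedQ_charpoly {R : Type*} [CommRing R] (Y : R) : (reducedQ Y).charpoly =
    X ^ 4 - C (16 * Y + 1) * X ^ 3 - C (16 * Y) * X ^ 2 + C (512 * Y ^ 3 - 64 * Y ^ 2) * X +
      C (1024 * Y ^ 4) := by
  rw [Matrix.charpoly, Matrix.det_succ_row_zero]
  simp [Fin.sum_univ_succ, Matrix.det_fin_three, Matrix.charmatrix_apply, reducedQ,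
    Matrix.diagonal_apply, Fin.succAbove]
  simp only [show (C 8 : R[X]) = 8 from rfl, show (C 4 : R[X]) = 4 from rfl,
    show (C 2 : R[X]) = 2 from rfl, show (C 16 : R[X]) = 16 from rfl,
    show (C 64 : R[X]) = 64 from rfl, show (C 512 : R[X]) = 512 from rfl,
    show (C 1024 : R[X]) = 1024 from rfl]
  ring

section Field

variable {K : Type*} [Field K]

/-- The discriminant of the characteristic polynomial is `Y ^ 7` times the cubic polynomial in the
conclusion, up to a constant; the coefficients below are cofactors of the Sylvester matrix. -/
theorem discr_eq_zero_of_double_root {Y l : K} (h2 : (24576 : K) ≠ 0)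
    (h : l ^ 4 - (16 * Y + 1) * l ^ 3 - 16 * Y * l ^ 2 + (512 * Y ^ 3 - 64 * Y ^ 2) * l +
      1024 * Y ^ 4 = 0)
    (h' : 4 * l ^ 3 - 3 * (16 * Y + 1) * l ^ 2 - 32 * Y * l + (512 * Y ^ 3 - 64 * Y ^ 2) = 0)
    (hY : Y ≠ 0) : 55296 * Y ^ 3 - 2880 * Y ^ 2 + 465 * Y + 6 = 0 := by
  have : (24576 : K) * Y ^ 5 * (55296 * Y ^ 3 - 2880 * Y ^ 2 + 465 * Y + 6) = 0 := by
    linear_combination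
      -((-4 - 160 * Y + 12672 * Y ^ 2 - 184320 * Y ^ 3) * l ^ 2 +
        (3 + 200 * Y - 4864 * Y ^ 2 + 2801664 * Y ^ 4) * l +
        (8 * Y - 1400 * Y ^ 2 - 163840 * Y ^ 3 + 866304 * Y ^ 4 - 8257536 * Y ^ 5)) * h -
      ((1 + 40 * Y - 3168 * Y ^ 2 + 46080 * Y ^ 3) * l ^ 3 +
        (-1 - 64 * Y + 1848 * Y ^ 2 + 1152 * Y ^ 3 - 884736 * Y ^ 4) * l ^ 2 +
        (-8 * Y + 232 * Y ^ 2 + 69888 * Y ^ 3 - 534528 * Y ^ 4 + 2654208 * Y ^ 5) * l +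
        (2432 * Y ^ 3 + 175616 * Y ^ 4 - 2322432 * Y ^ 5 + 16515072 * Y ^ 6)) * h'
  simpa [h2, hY] using this

namespace Radicals

variable {Y : K} (ρ : Radicals Y)

theorem z_relation : (ρ.z ^ 3 - (13824 * Y ^ 6 - 864 * Y ^ 5 + 207 * Y ^ 4 + Y ^ 3)) ^ 2 =
    81 * (55296 * Y ^ 10 - 2880 * Y ^ 9 + 465 * Y ^ 8 + 6 * Y ^ 7) := by
  rw [ρ.z_cube, ← ρ.s_sq]
  ring

theorem w_relation : ρ.w ^ 2 * ρ.z = 18432 * Y ^ 4 + 768 * ρ.z * Y ^ 2 - 768 * Y ^ 3 +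
    32 * ρ.z ^ 2 + 224 * Y * ρ.z + 32 * Y ^ 2 + 3 * ρ.z := by
  rw [ρ.w_sq, div_mul_cancel₀ _ ρ.z_ne]

/-- Half the sum of `p ^ 2` and `q ^ 2`. -/
def halfSum : K := radG Y ρ.z ρ.w / (ρ.w * ρ.z)

/-- Half the difference of `p ^ 2` and `q ^ 2`. -/
def halfDiff : K := radH ρ.r Y ρ.z / (ρ.w * ρ.z)

theorem p_sq_eq : ρ.p ^ 2 = ρ.halfSum + ρ.halfDiff := by
  rw [ρ.p_sq, add_div, halfSum, halfDiff]

theorem q_sq_eq : ρ.q ^ 2 = ρ.halfSum - ρ.halfDiff := by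
  rw [ρ.q_sq, sub_div, halfSum, halfDiff]

theorem halfSum_mul : ρ.halfSum * ρ.z = -55296 * Y ^ 4 + 4608 * ρ.z * Y ^ 2 + 2304 * Y ^ 3 -
    96 * ρ.z ^ 2 + 1344 * Y * ρ.z - 96 * Y ^ 2 + 18 * ρ.z := by
  have hz := ρ.z_ne
  have hw := ρ.w_ne
  rw [halfSum, radG]
  field_simp

theorem halfDiff_mul : ρ.halfDiff * ρ.w = 18 * (2304 * Y ^ 2 + 112 * Y + 1) * ρ.r := by
  have hz := ρ.z_ne
  have hw := ρ.w_ne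
  rw [halfDiff, radH]
  field_simp
  ring

theorem halfSum_eq : ρ.halfSum + 3 * ρ.w ^ 2 = 6912 * Y ^ 2 + 2016 * Y + 27 := by
  refine mul_right_cancel₀ ρ.z_ne ?_
  linear_combination ρ.halfSum_mul + 3 * ρ.w_relation

theorem r_mul_w_sq : (ρ.r * ρ.w) ^ 2 = 3 * ρ.w ^ 2 := by
  rw [mul_pow, ρ.r_sq]

theorem r_w_halfDiff : ρ.r * ρ.w * ρ.halfDiff = 54 * (2304 * Y ^ 2 + 112 * Y + 1) := by
  linear_combination ρ.r * ρ.halfDiff_mul + 18 * (2304 * Y ^ 2 + 112 * Y + 1) * ρ.r_sq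

theorem halfDiff_sq : ρ.halfDiff ^ 2 * ρ.w ^ 2 = 972 * (2304 * Y ^ 2 + 112 * Y + 1) ^ 2 := by
  rw [← mul_pow, halfDiff_mul, mul_pow, ρ.r_sq]
  ring

end Radicals

/-- The cubic resolvent of the characteristic polynomial, with its root `W = w ^ 2`. -/
theorem resolvent_eq_zero [CharZero K] {Y z W : K} (hz : z ≠ 0)
    (hz' : (z ^ 3 - (13824 * Y ^ 6 - 864 * Y ^ 5 + 207 * Y ^ 4 + Y ^ 3)) ^ 2 =
      81 * (55296 * Y ^ 10 - 2880 * Y ^ 9 + 465 * Y ^ 8 + 6 * Y ^ 7))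
    (hW : W * z = 18432 * Y ^ 4 + 768 * z * Y ^ 2 - 768 * Y ^ 3 +
      32 * z ^ 2 + 224 * Y * z + 32 * Y ^ 2 + 3 * z) :
    W * (W ^ 2 / 576 - W * (48 * Y ^ 2 + 14 * Y + 3 / 16) / 12 +
      (32 * Y ^ 2 + 12 * Y + 1 / 8) ^ 2 + (4 * Y + 1 / 4) * (2304 * Y ^ 2 + 112 * Y + 1) / 8 -
      1024 * Y ^ 4) - 3 * (2304 * Y ^ 2 + 112 * Y + 1) ^ 2 / 64 = 0 := by
  refine (mul_eq_zero.1 ?_).resolve_right (pow_ne_zero 3 hz)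
  linear_combination ((1 / 576) * ((W * z) ^ 2 + W * z * (18432 * Y ^ 4 + 768 * z * Y ^ 2 -
      768 * Y ^ 3 + 32 * z ^ 2 + 224 * Y * z + 32 * Y ^ 2 + 3 * z) + (18432 * Y ^ 4 +
      768 * z * Y ^ 2 - 768 * Y ^ 3 + 32 * z ^ 2 + 224 * Y * z + 32 * Y ^ 2 + 3 * z) ^ 2) -
    (48 * Y ^ 2 + 14 * Y + 3 / 16) / 12 * z * (W * z + (18432 * Y ^ 4 + 768 * z * Y ^ 2 -
      768 * Y ^ 3 + 32 * z ^ 2 + 224 * Y * z + 32 * Y ^ 2 + 3 * z)) +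
    ((32 * Y ^ 2 + 12 * Y + 1 / 8) ^ 2 + (4 * Y + 1 / 4) * (2304 * Y ^ 2 + 112 * Y + 1) / 8 -
      1024 * Y ^ 4) * z ^ 2) * hW + 512 / 9 * hz'

namespace Radicals

variable [CharZero K] {Y : K} (ρ : Radicals Y)

theorem eigenvalue_pair_add : ρ.eigenvalue 0 + ρ.eigenvalue 1 =
      2 * (4 * Y + 1 / 4 + ρ.r * ρ.w / 12) ∧
    ρ.eigenvalue 2 + ρ.eigenvalue 3 = 2 * (4 * Y + 1 / 4 - ρ.r * ρ.w / 12) := by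
  constructor <;> simp [eigenvalue] <;> ring

theorem eigenvalue_pair_mul : ρ.eigenvalue 0 * ρ.eigenvalue 1 =
      (4 * Y + 1 / 4 + ρ.r * ρ.w / 12) ^ 2 - (ρ.halfSum + ρ.halfDiff) / 144 ∧
    ρ.eigenvalue 2 * ρ.eigenvalue 3 =
      (4 * Y + 1 / 4 - ρ.r * ρ.w / 12) ^ 2 - (ρ.halfSum - ρ.halfDiff) / 144 := by
  rw [← ρ.p_sq_eq, ← ρ.q_sq_eq]
  constructor <;> simp [eigenvalue] <;> ring

/-- The eigenvalues, in two pairs, solve the quartic equation; this is Ferrari's method. -/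
theorem charpoly_eq : (reducedQ Y).charpoly = ∏ i, (X - C (ρ.eigenvalue i)) := by
  obtain ⟨a1, a2⟩ := ρ.eigenvalue_pair_add
  obtain ⟨m1, m2⟩ := ρ.eigenvalue_pair_mul
  have hS : ρ.halfSum = 6912 * Y ^ 2 + 2016 * Y + 27 - 3 * ρ.w ^ 2 :=
    eq_sub_of_add_eq ρ.halfSum_eq
  have hR := resolvent_eq_zero ρ.z_ne ρ.z_relation ρ.w_relation
  have e1 : ρ.eigenvalue 0 + ρ.eigenvalue 1 + (ρ.eigenvalue 2 + ρ.eigenvalue 3) = 16 * Y + 1 := by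
    rw [a1, a2]
    ring
  have e2 : ρ.eigenvalue 0 * ρ.eigenvalue 1 + ρ.eigenvalue 2 * ρ.eigenvalue 3 +
      (ρ.eigenvalue 0 + ρ.eigenvalue 1) * (ρ.eigenvalue 2 + ρ.eigenvalue 3) = -(16 * Y) := by
    rw [a1, a2, m1, m2, hS]
    linear_combination (-2 / 144) * ρ.r_mul_w_sq
  have e3 : ρ.eigenvalue 0 * ρ.eigenvalue 1 * (ρ.eigenvalue 2 + ρ.eigenvalue 3) +
      ρ.eigenvalue 2 * ρ.eigenvalue 3 * (ρ.eigenvalue 0 + ρ.eigenvalue 1) =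
      -(512 * Y ^ 3 - 64 * Y ^ 2) := by
    rw [a1, a2, m1, m2, hS]
    linear_combination (-(4 * (4 * Y + 1 / 4)) / 144) * ρ.r_mul_w_sq + (4 / 1728) * ρ.r_w_halfDiff
  have e4 : ρ.eigenvalue 0 * ρ.eigenvalue 1 * (ρ.eigenvalue 2 * ρ.eigenvalue 3) =
      1024 * Y ^ 4 := by
    refine mul_right_cancel₀ (pow_ne_zero 2 ρ.w_ne) ?_
    have hex : ρ.eigenvalue 0 * ρ.eigenvalue 1 * (ρ.eigenvalue 2 * ρ.eigenvalue 3) =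
        ((4 * Y + 1 / 4) ^ 2 - (ρ.r * ρ.w) ^ 2 / 144) ^ 2 -
        (2 * ((4 * Y + 1 / 4) ^ 2 + (ρ.r * ρ.w) ^ 2 / 144) * ρ.halfSum -
          (4 * Y + 1 / 4) / 3 * (ρ.r * ρ.w * ρ.halfDiff)) / 144 +
        (ρ.halfSum ^ 2 - ρ.halfDiff ^ 2) / 20736 := by
      rw [m1, m2]
      ring
    rw [hex, r_mul_w_sq, r_w_halfDiff, hS]
    linear_combination hR - (1 / 20736) * ρ.halfDiff_sq
  rw [reducedQ_charpoly, Fin.prod_univ_four]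
  have : (X - C (ρ.eigenvalue 0)) * (X - C (ρ.eigenvalue 1)) * (X - C (ρ.eigenvalue 2)) *
      (X - C (ρ.eigenvalue 3)) = X ^ 4 -
      C (ρ.eigenvalue 0 + ρ.eigenvalue 1 + (ρ.eigenvalue 2 + ρ.eigenvalue 3)) * X ^ 3 +
      C (ρ.eigenvalue 0 * ρ.eigenvalue 1 + ρ.eigenvalue 2 * ρ.eigenvalue 3 +
        (ρ.eigenvalue 0 + ρ.eigenvalue 1) * (ρ.eigenvalue 2 + ρ.eigenvalue 3)) * X ^ 2 -
      C (ρ.eigenvalue 0 * ρ.eigenvalue 1 * (ρ.eigenvalue 2 + ρ.eigenvalue 3) +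
        ρ.eigenvalue 2 * ρ.eigenvalue 3 * (ρ.eigenvalue 0 + ρ.eigenvalue 1)) * X +
      C (ρ.eigenvalue 0 * ρ.eigenvalue 1 * (ρ.eigenvalue 2 * ρ.eigenvalue 3)) := by
    simp only [map_add, map_mul]
    ring
  rw [this, e1, e2, e3, e4, C_neg, C_neg]
  ring

theorem eval_charpoly (i : Fin 4) : ρ.eigenvalue i ^ 4 - (16 * Y + 1) * ρ.eigenvalue i ^ 3 -
    16 * Y * ρ.eigenvalue i ^ 2 + (512 * Y ^ 3 - 64 * Y ^ 2) * ρ.eigenvalue i +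
      1024 * Y ^ 4 = 0 := by
  have h : (reducedQ Y).charpoly.eval (ρ.eigenvalue i) = 0 := by
    rw [ρ.charpoly_eq, eval_prod]
    exact Finset.prod_eq_zero (Finset.mem_univ i) (by simp)
  rw [reducedQ_charpoly] at h
  simpa using h

theorem eigenvalue_injective (hY : Y ≠ 0)
    (hdisc : 55296 * Y ^ 3 - 2880 * Y ^ 2 + 465 * Y + 6 ≠ 0) :
    Function.Injective ρ.eigenvalue := by
  intro i k hik
  by_contra hne
  refine hdisc (discr_eq_zero_of_double_root (l := ρ.eigenvalue i) (by norm_num)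
    (ρ.eval_charpoly i) ?_ hY)
  have hdvd : (X - C (ρ.eigenvalue i)) ^ 2 ∣ (reducedQ Y).charpoly := by
    rw [ρ.charpoly_eq, ← Finset.mul_prod_erase _ _ (Finset.mem_univ i),
      ← Finset.mul_prod_erase _ _ (Finset.mem_erase.2 ⟨Ne.symm hne, Finset.mem_univ k⟩), ← hik,
      ← mul_assoc, ← pow_two]
    exact dvd_mul_right _ _
  obtain ⟨q, hq⟩ := hdvd
  have h := congrArg (fun p => (derivative p).eval (ρ.eigenvalue i)) hq
  simp only [reducedQ_charpoly] at h
  simp [derivative_mul, derivative_pow] at h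
  linear_combination h

end Radicals

/-- The characteristic polynomial takes the value `64 * Y ^ 3 * (4 * Y + 1)` at `-4 * Y` and
`9216 * Y ^ 4` at `-8 * Y`. -/
theorem denominators_ne_zero [CharZero K] {Y l : K} (hY : Y ≠ 0) (hY' : 4 * Y + 1 ≠ 0)
    (h : l ^ 4 - (16 * Y + 1) * l ^ 3 - 16 * Y * l ^ 2 + (512 * Y ^ 3 - 64 * Y ^ 2) * l +
      1024 * Y ^ 4 = 0) : 4 * Y + l ≠ 0 ∧ 8 * Y + l ≠ 0 := by
  constructor <;> intro hl
  · have : 64 * Y ^ 3 * (4 * Y + 1) = 0 := by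
      obtain rfl : l = -(4 * Y) := by linear_combination hl
      linear_combination h
    simp [hY, hY'] at this
  · have : 9216 * Y ^ 4 = 0 := by
      obtain rfl : l = -(8 * Y) := by linear_combination hl
      linear_combination h
    simp [hY] at this

/-- The vector with the entries `φ₁(l), φ₂(l), φ₃(l), 1` is an eigenvector. -/
theorem reducedQ_mulVec_phi {Y l : K} (h0 : Y ≠ 0) (h2 : (2 : K) ≠ 0) (h4 : 4 * Y + l ≠ 0)
    (h8 : 8 * Y + l ≠ 0)
    (h : l ^ 4 - (16 * Y + 1) * l ^ 3 - 16 * Y * l ^ 2 + (512 * Y ^ 3 - 64 * Y ^ 2) * l +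
      1024 * Y ^ 4 = 0) :
    (reducedQ Y).mulVec ![phi₁ Y l, phi₂ Y l, phi₃ Y l, 1] =
      l • ![phi₁ Y l, phi₂ Y l, phi₃ Y l, 1] := by
  have hD : l ^ 2 + 12 * Y * l + 32 * Y ^ 2 ≠ 0 := by
    rw [show l ^ 2 + 12 * Y * l + 32 * Y ^ 2 = (4 * Y + l) * (8 * Y + l) by ring]
    exact mul_ne_zero h4 h8
  have q1 : phi₁ Y l * (Y * (4 * Y + l)) = l := div_mul_cancel₀ _ (mul_ne_zero h0 h4)
  have q2 : phi₂ Y l * (2 * Y * (l ^ 2 + 12 * Y * l + 32 * Y ^ 2)) =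
      l * (l ^ 2 - (8 * Y + 1) * l - 32 * Y ^ 2 - 8 * Y) :=
    div_mul_cancel₀ _ (mul_ne_zero (mul_ne_zero h2 h0) hD)
  have q3 : phi₃ Y l * (l ^ 2 + 12 * Y * l + 32 * Y ^ 2) =
      2 * (l ^ 2 - 8 * Y * l - 32 * Y ^ 2) := div_mul_cancel₀ _ hD
  have hM : 2 * Y * (l ^ 2 + 12 * Y * l + 32 * Y ^ 2) ≠ 0 := mul_ne_zero (mul_ne_zero h2 h0) hD
  funext i
  refine mul_right_cancel₀ hM ?_
  fin_cases i <;>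
    simp [reducedQ, Matrix.mulVec, dotProduct, Fin.sum_univ_four, -mul_eq_mul_right_iff]
  · linear_combination (1 - l) * 2 * (8 * Y + l) * q1 + 2 * q2 + 8 * Y * q3
  · linear_combination 16 * Y * (8 * Y + l) * q1 + (8 * Y - l) * q2 + 16 * Y ^ 2 * q3 - h
  · linear_combination 4 * Y * (8 * Y + l) * q1 + 4 * Y * q2 - 2 * Y * l * q3
  · linear_combination (4 * Y ^ 2 + Y) * 2 * (8 * Y + l) * q1 + 2 * Y * q2 + 8 * Y ^ 2 * q3

/-- Distinct roots of the characteristic polynomial give linearly independent eigenvectors. -/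
theorem transitionN_diagonalizes [CharZero K] {Y : K} {l : Fin 4 → K} (hY : Y ≠ 0)
    (hY' : 4 * Y + 1 ≠ 0) (hl : Function.Injective l)
    (h : ∀ i, l i ^ 4 - (16 * Y + 1) * l i ^ 3 - 16 * Y * l i ^ 2 +
      (512 * Y ^ 3 - 64 * Y ^ 2) * l i + 1024 * Y ^ 4 = 0) :
    IsUnit (transitionN Y l) ∧
      (transitionN Y l)⁻¹ * reducedQ Y * transitionN Y l = Matrix.diagonal l := by
  have hcol : ∀ i, (transitionN Y l).col i = ![phi₁ Y (l i), phi₂ Y (l i), phi₃ Y (l i), 1] :=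
    fun i => rfl
  have hvec : ∀ i, (reducedQ Y).mulVec ((transitionN Y l).col i) =
      l i • (transitionN Y l).col i := fun i => by
    obtain ⟨h4, h8⟩ := denominators_ne_zero hY hY' (h i)
    rw [hcol]
    exact reducedQ_mulVec_phi hY two_ne_zero h4 h8 (h i)
  have hunit : IsUnit (transitionN Y l) := by
    rw [← Matrix.linearIndependent_cols_iff_isUnit]
    refine Module.End.eigenvectors_linearIndependent' (Matrix.toLin' (reducedQ Y)) l hl _
      fun i => ?_
    rw [Module.End.hasEigenvector_iff, Module.End.mem_eigenspace_iff]
    refine ⟨by rw [Matrix.toLin'_apply, hvec], fun h0 => ?_⟩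
    have := congrFun h0 3
    rw [hcol] at this
    simp at this
  refine ⟨hunit, ?_⟩
  have hmul : reducedQ Y * transitionN Y l = transitionN Y l * Matrix.diagonal l := by
    ext i k
    rw [Matrix.mul_diagonal]
    have := congrFun (hvec k) i
    rw [Pi.smul_apply, smul_eq_mul, mul_comm] at this
    exact this
  rw [Matrix.mul_assoc, hmul, ← Matrix.mul_assoc,
    Matrix.nonsing_inv_mul _ ((Matrix.isUnit_iff_isUnit_det _).1 hunit), Matrix.one_mul]

theorem pow_eq_of_diagonalizes {n : Type*} [Fintype n] [DecidableEq n] {N Q : Matrix n n K}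
    {l : n → K} (hN : IsUnit N) (h : N⁻¹ * Q * N = Matrix.diagonal l) (k : ℕ) :
    Q ^ k = N * Matrix.diagonal (fun i => l i ^ k) * N⁻¹ := by
  have hdet := (Matrix.isUnit_iff_isUnit_det _).1 hN
  have h1 : N * N⁻¹ = 1 := Matrix.mul_nonsing_inv _ hdet
  have hQ : Q * N = N * Matrix.diagonal l := by
    rw [← h, ← Matrix.mul_assoc, ← Matrix.mul_assoc, h1, Matrix.one_mul]
  have key : Q ^ k * N = N * Matrix.diagonal (fun i => l i ^ k) := by
    induction k with
    | zero => simp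
    | succ k ih =>
      rw [pow_succ, Matrix.mul_assoc, hQ, ← Matrix.mul_assoc, ih, Matrix.mul_assoc,
        Matrix.diagonal_mul_diagonal]
      simp only [pow_succ]
  rw [← key, Matrix.mul_assoc, h1, Matrix.mul_one]

/-- The condition on `576 * Y ^ 2 - 24 * Y + 1` ensures that `z ≠ 0`, the one on
`2304 * Y ^ 2 + 112 * Y + 1` that `w ≠ 0`. -/
theorem nonempty_radicals [CharZero K] [IsAlgClosed K] {Y : K} (hY : Y ≠ 0)
    (h1 : 576 * Y ^ 2 - 24 * Y + 1 ≠ 0) (h2 : 2304 * Y ^ 2 + 112 * Y + 1 ≠ 0) :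
    Nonempty (Radicals Y) := by
  obtain ⟨r, hr⟩ := IsAlgClosed.exists_pow_nat_eq (3 : K) two_pos
  obtain ⟨s, hs⟩ := IsAlgClosed.exists_pow_nat_eq
    (55296 * Y ^ 10 - 2880 * Y ^ 9 + 465 * Y ^ 8 + 6 * Y ^ 7) two_pos
  obtain ⟨z, hz⟩ := IsAlgClosed.exists_pow_nat_eq
    (13824 * Y ^ 6 - 864 * Y ^ 5 + 207 * Y ^ 4 + Y ^ 3 + 9 * s) three_pos
  have hz' : (z ^ 3 - (13824 * Y ^ 6 - 864 * Y ^ 5 + 207 * Y ^ 4 + Y ^ 3)) ^ 2 =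
      81 * (55296 * Y ^ 10 - 2880 * Y ^ 9 + 465 * Y ^ 8 + 6 * Y ^ 7) := by
    rw [hz, ← hs]
    ring
  have hz0 : z ≠ 0 := by
    rintro rfl
    -- the product of the two values of `z ^ 3` is the cube of `Y ^ 2 * (576 * Y ^ 2 - 24 * Y + 1)`
    have : (Y ^ 2 * (576 * Y ^ 2 - 24 * Y + 1)) ^ 3 = 0 := by linear_combination hz'
    exact pow_ne_zero 3 (mul_ne_zero (pow_ne_zero 2 hY) h1) this
  obtain ⟨w, hw⟩ := IsAlgClosed.exists_pow_nat_eq ((18432 * Y ^ 4 + 768 * z * Y ^ 2 -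
    768 * Y ^ 3 + 32 * z ^ 2 + 224 * Y * z + 32 * Y ^ 2 + 3 * z) / z) two_pos
  have hw0 : w ≠ 0 := by
    intro h0
    have hR := resolvent_eq_zero (W := w ^ 2) hz0 hz' (by rw [hw, div_mul_cancel₀ _ hz0])
    rw [h0] at hR
    have : (2304 * Y ^ 2 + 112 * Y + 1) ^ 2 = 0 := by linear_combination (-64 / 3) * hR
    exact pow_ne_zero 2 h2 this
  obtain ⟨p, hp⟩ := IsAlgClosed.exists_pow_nat_eq ((radG Y z w + radH r Y z) / (w * z)) two_pos
  obtain ⟨q, hq⟩ := IsAlgClosed.exists_pow_nat_eq ((radG Y z w - radH r Y z) / (w * z)) two_pos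
  exact ⟨⟨r, s, z, w, p, q, hr, hs, hz, hz0, hw, hw0, hp, hq⟩⟩

end Field

theorem exists_principal_radicals {Y : ℝ} (hY : 0 < Y) :
    ∃ (z w : ℝ) (ρ : Radicals (Y : ℂ)),
      0 < 55296 * Y ^ 3 - 2880 * Y ^ 2 + 465 * Y + 6 ∧ 0 < z ∧ 0 < w ∧
      z = (13824 * Y ^ 6 - 864 * Y ^ 5 + 207 * Y ^ 4 + Y ^ 3
        + 9 * √(55296 * Y ^ 10 - 2880 * Y ^ 9 + 465 * Y ^ 8 + 6 * Y ^ 7)) ^ (1 / 3 : ℝ) ∧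
      w = √((18432 * Y ^ 4 + 768 * z * Y ^ 2 - 768 * Y ^ 3 + 32 * z ^ 2 + 224 * Y * z
        + 32 * Y ^ 2 + 3 * z) / z) ∧
      ρ.r = (√3 : ℝ) ∧ ρ.z = z ∧ ρ.w = w ∧
      ρ.s = (√(55296 * Y ^ 10 - 2880 * Y ^ 9 + 465 * Y ^ 8 + 6 * Y ^ 7) : ℝ) ∧
      ρ.p = (((radG Y z w + radH (√3) Y z) / (w * z) : ℝ) : ℂ) ^ (1 / 2 : ℂ) ∧
      ρ.q = (((radG Y z w - radH (√3) Y z) / (w * z) : ℝ) : ℂ) ^ (1 / 2 : ℂ) := by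
  have hcubic : 0 < 55296 * Y ^ 3 - 2880 * Y ^ 2 + 465 * Y + 6 := by
    have : 0 ≤ Y * (55296 * (Y - 1440 / 55296) ^ 2 + 300) := by positivity
    nlinarith
  set S := 55296 * Y ^ 10 - 2880 * Y ^ 9 + 465 * Y ^ 8 + 6 * Y ^ 7 with hS
  have hS0 : 0 ≤ S := by
    have : S = Y ^ 7 * (55296 * Y ^ 3 - 2880 * Y ^ 2 + 465 * Y + 6) := by rw [hS]; ring
    rw [this]
    positivity
  set U := 13824 * Y ^ 6 - 864 * Y ^ 5 + 207 * Y ^ 4 + Y ^ 3 + 9 * √S with hU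
  have hU0 : 0 < U := by
    have h : 0 < Y ^ 4 * (13824 * (Y - 1 / 32) ^ 2 + 193) + Y ^ 3 := by positivity
    have h' := Real.sqrt_nonneg S
    nlinarith
  set z := U ^ (1 / 3 : ℝ) with hz
  have hz0 : 0 < z := Real.rpow_pos_of_pos hU0 _
  have hz3 : z ^ 3 = U := by
    rw [hz, ← Real.rpow_natCast, ← Real.rpow_mul hU0.le]
    norm_num
  set W := (18432 * Y ^ 4 + 768 * z * Y ^ 2 - 768 * Y ^ 3 + 32 * z ^ 2 + 224 * Y * z
        + 32 * Y ^ 2 + 3 * z) / z with hW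
  have hW0 : 0 < W := by
    refine div_pos ?_ hz0
    have h : 0 < Y ^ 2 * (18432 * (Y - 1 / 48) ^ 2 + 24) + 768 * z * Y ^ 2 + 32 * z ^ 2 +
      224 * Y * z + 3 * z := by positivity
    nlinarith
  set w := √W with hw
  have hw0 : 0 < w := Real.sqrt_pos.2 hW0
  have hroot : ∀ x : ℂ, (x ^ (1 / 2 : ℂ)) ^ 2 = x := fun x => by
    have := Complex.cpow_nat_inv_pow x two_ne_zero
    rwa [Nat.cast_ofNat, ← one_div] at this
  refine ⟨z, w, ⟨(√3 : ℝ), (√S : ℝ), z, w,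
    (((radG Y z w + radH (√3) Y z) / (w * z) : ℝ) : ℂ) ^ (1 / 2 : ℂ),
    (((radG Y z w - radH (√3) Y z) / (w * z) : ℝ) : ℂ) ^ (1 / 2 : ℂ), ?_, ?_, ?_, ?_, ?_, ?_, ?_,
      ?_⟩, hcubic, hz0, hw0, rfl, rfl, rfl, rfl, rfl, rfl, rfl, rfl⟩
  · rw [← Complex.ofReal_pow, Real.sq_sqrt (by norm_num)]
    norm_num
  · rw [← Complex.ofReal_pow, Real.sq_sqrt hS0, hS]
    push_cast
    ring
  · rw [← Complex.ofReal_pow, hz3, hU]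
    push_cast
    ring
  · exact Complex.ofReal_ne_zero.2 hz0.ne'
  · rw [← Complex.ofReal_pow, Real.sq_sqrt hW0.le, hW]
    push_cast
    ring
  · exact Complex.ofReal_ne_zero.2 hw0.ne'
  · rw [hroot]
    simp only [radG, radH]
    push_cast
    ring
  · rw [hroot]
    simp only [radG, radH]
    push_cast
    ring

/-! ### Conclusion -/

theorem aeval_reducedQ_pow_mulVec {K : Type*} [Field K] (Y : K) (k : ℕ) (i : Fin 4) :
    aeval Y ((reducedQ (X : ℤ[X]) ^ k).mulVec ![2, 0, 0, 2 * X] i) =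
      (reducedQ Y ^ k).mulVec ![2, 0, 0, 2 * Y] i := by
  have key : ∀ φ : ℤ[X] →+* K, φ X = Y →
      φ ((reducedQ (X : ℤ[X]) ^ k).mulVec ![2, 0, 0, 2 * X] i) =
        (reducedQ Y ^ k).mulVec ![2, 0, 0, 2 * Y] i := by
    intro φ hφ
    have h2 : φ 2 = 2 := map_ofNat φ 2
    have h4 : φ 4 = 4 := map_ofNat φ 4
    have h8 : φ 8 = 8 := map_ofNat φ 8
    have hQ : (reducedQ (X : ℤ[X])).map φ = reducedQ Y := by
      ext i k
      fin_cases i <;> fin_cases k <;> simp [reducedQ, hφ, h2, h4, h8]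
    have hv : (fun i => φ (![2, 0, 0, 2 * X] i)) = ![2, 0, 0, 2 * Y] := by
      funext i
      fin_cases i <;> simp [hφ, h2]
    have h := RingHom.map_mulVec φ (reducedQ (X : ℤ[X]) ^ k) ![2, 0, 0, 2 * X] i
    rw [Matrix.map_pow, hQ] at h
    exact h.trans (congrArg (fun v => (reducedQ Y ^ k).mulVec v i) hv)
  exact key (aeval Y : ℤ[X] →ₐ[ℤ] K).toRingHom (aeval_X Y)

theorem mainTheorem2 :
    -- the characteristic polynomial of the reduced transfer matrix (over `ℤ[Y]`)
    ((reducedQ (X : ℤ[X])).charpoly =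
      X ^ 4 - C (16 * X + 1) * X ^ 3 - C (16 * X) * X ^ 2
        + C (512 * X ^ 3 - 64 * X ^ 2) * X + C (1024 * X ^ 4)) ∧
    -- `reducedQ` is the transfer matrix of the chain
    (∀ D : Constituents (Fin 4), D = hexagonalConstituents ∨ D = pathConstituents →
      ∀ n : ℕ, 1 ≤ n →
        alphaHat D n = (reducedQ (X : ℤ[X]) ^ (n - 1)).mulVec ![2, 0, 0, 2 * X]) ∧
    -- eigenvalues, diagonalization and explicit solution, for every choice of the radicals
    (∀ (K : Type*) [Field K] [CharZero K] (Y : K),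
      Y ≠ 0 → 4 * Y + 1 ≠ 0 → 55296 * Y ^ 3 - 2880 * Y ^ 2 + 465 * Y + 6 ≠ 0 →
      ∀ ρ : Radicals Y,
        (reducedQ Y).charpoly = ∏ i, (X - C (ρ.eigenvalue i)) ∧
        Function.Injective ρ.eigenvalue ∧
        (∀ i, Y * (4 * Y + ρ.eigenvalue i) ≠ 0 ∧
          ρ.eigenvalue i ^ 2 + 12 * Y * ρ.eigenvalue i + 32 * Y ^ 2 ≠ 0) ∧
        IsUnit (transitionN Y ρ.eigenvalue) ∧
        (transitionN Y ρ.eigenvalue)⁻¹ * reducedQ Y * transitionN Y ρ.eigenvalue =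
          Matrix.diagonal ρ.eigenvalue ∧
        ∀ D : Constituents (Fin 4), D = hexagonalConstituents ∨ D = pathConstituents →
          ∀ n : ℕ, 1 ≤ n →
            (fun i => aeval Y (alphaHat D n i)) =
              (transitionN Y ρ.eigenvalue *
                Matrix.diagonal (fun i => ρ.eigenvalue i ^ (n - 1)) *
                (transitionN Y ρ.eigenvalue)⁻¹).mulVec ![2, 0, 0, 2 * Y]) ∧
    -- over an algebraically closed field the radicals exist for all but finitely many `Y`
    (∀ (K : Type*) [Field K] [CharZero K] [IsAlgClosed K] (Y : K),
      Y ≠ 0 → 576 * Y ^ 2 - 24 * Y + 1 ≠ 0 → 2304 * Y ^ 2 + 112 * Y + 1 ≠ 0 →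
      Nonempty (Radicals Y)) ∧
    -- for real `Y > 0` one can take the principal values of all radicals
    (∀ Y : ℝ, 0 < Y → ∃ (z w : ℝ) (ρ : Radicals (Y : ℂ)),
      0 < 55296 * Y ^ 3 - 2880 * Y ^ 2 + 465 * Y + 6 ∧ 0 < z ∧ 0 < w ∧
      z = (13824 * Y ^ 6 - 864 * Y ^ 5 + 207 * Y ^ 4 + Y ^ 3
        + 9 * √(55296 * Y ^ 10 - 2880 * Y ^ 9 + 465 * Y ^ 8 + 6 * Y ^ 7)) ^ (1 / 3 : ℝ) ∧
      w = √((18432 * Y ^ 4 + 768 * z * Y ^ 2 - 768 * Y ^ 3 + 32 * z ^ 2 + 224 * Y * z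
        + 32 * Y ^ 2 + 3 * z) / z) ∧
      ρ.r = (√3 : ℝ) ∧ ρ.z = z ∧ ρ.w = w ∧
      ρ.s = (√(55296 * Y ^ 10 - 2880 * Y ^ 9 + 465 * Y ^ 8 + 6 * Y ^ 7) : ℝ) ∧
      ρ.p = (((radG Y z w + radH (√3) Y z) / (w * z) : ℝ) : ℂ) ^ (1 / 2 : ℂ) ∧
      ρ.q = (((radG Y z w - radH (√3) Y z) / (w * z) : ℝ) : ℂ) ^ (1 / 2 : ℂ)) := by
  refine ⟨reducedQ_charpoly X, fun D hD n hn => alphaHat_eq_mulVec hD hn, ?_, ?_, ?_⟩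
  · intro K _ _ Y hY hY' hdisc ρ
    have hinj := ρ.eigenvalue_injective hY hdisc
    obtain ⟨hunit, hdiag⟩ := transitionN_diagonalizes hY hY' hinj ρ.eval_charpoly
    refine ⟨ρ.charpoly_eq, hinj, fun i => ?_, hunit, hdiag, fun D hD n hn => ?_⟩
    · obtain ⟨h4, h8⟩ := denominators_ne_zero hY hY' (ρ.eval_charpoly i)
      refine ⟨mul_ne_zero hY h4, fun h => mul_ne_zero h4 h8 ?_⟩
      rw [← h]
      ring
    · funext i
      rw [alphaHat_eq_mulVec hD hn, aeval_reducedQ_pow_mulVec, pow_eq_of_diagonalizes hunit hdiag]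
  · intro K _ _ _ Y hY h1 h2
    exact nonempty_radicals hY h1 h2
  · intro Y hY
    exact exists_principal_radicals hY
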